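/- For $n\ge 1$ and a permutation $\pi$ of $\mathbb{Z}_{2n+1}=\mathbb{Z}/(2n+1)\mathbb{Z}$, whose values are compared as elements of $\{0,\dots,2n\}$, let the writhe of $\pi$ be $$w(\pi)=\sum_{i=0}^{2n}\sum_{j=1}^{n}\operatorname{sign}\bigl(\pi(i+j)-\pi(i)\bigr),$$ where $i+j$ is taken modulo $2n+1$. Let $W_{2n+1}=w(\pi)/n$ with $\pi$ a uniformly random permutation of $\mathbb{Z}_{2n+1}$. Let $\lambda_m=\dfrac{8^m(2^m-1)B_m^2}{2(m!)^2}$ for even $m\ge 2$, where $B_m$ is the $m$th Bernoulli number, and $\lambda_m=0$ for odd $m$. Then there is a probability distribution $W$ on $\mathbb{R}$, absolutely continuous with respect to Lebesgue measure, such that $$W_{2n+1}\;\xrightarrow[n\to\infty]{D}\;W .$$ For every complex $z$ with $|z|<\pi^2/4$ the expectation $\mathcal{M}(z)=E[e^{Wz}]$ exists, the series below converges, and $$\mathcal{M}(z)=\exp\left(\sum_{m=1}^{\infty}\frac{\lambda_m}{m}z^m\right),$$ and $W$ is the only probability distribution on $\mathbb{R}$ whose moment generating function exists and is given by this formula for all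 real $z$ in some neighborhood of $0$. The power series $\sum_{m\ge1}\frac{\lambda_m}{m}z^m$ is the expansion of $\log\mathcal{M}(z)$ at $0$ and has radius of convergence exactly $\pi^2/4$ (here $\pi=3.14\ldots$), and $$\lim_{t\to\infty}\frac1t\log P\bigl[|W|>t\bigr]=-\frac{\pi^2}{4}.$$ -/

import Mathlib

open MeasureTheory ProbabilityTheory Filter Topology

/-- The writhe of `f : ℤ/(2n+1) → ℝ`: the sum over all `i` and over `j = 1, …, n` of
`sign (f (i + j) - f i)`. -/
noncomputable def writhe (n : ℕ) (f : ZMod (2 * n + 1) → ℝ) : ℤ :=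
  ∑ i : ZMod (2 * n + 1), ∑ j ∈ Finset.Icc 1 n,
    (SignType.sign (f (i + (j : ZMod (2 * n + 1))) - f i) : ℤ)

/-- The writhe of a permutation of `ℤ/(2n+1)`, whose values are compared as elements of
`{0, …, 2n}`. -/
noncomputable def permWrithe (n : ℕ) (σ : Equiv.Perm (ZMod (2 * n + 1))) : ℤ :=
  writhe n (fun x => ((σ x).val : ℝ))

/-- The law of the normalized writhe `w(σ) / n` of a uniformly random permutation `σ` of
`ℤ/(2n+1)`. -/
noncomputable def normalizedWritheLaw (n : ℕ) : ProbabilityMeasure ℝ :=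
  ⟨((PMF.uniformOfFintype (Equiv.Perm (ZMod (2 * n + 1)))).map
      (fun σ => (permWrithe n σ : ℝ) / (n : ℝ))).toMeasure, inferInstance⟩

/-- `λ_m = 8^m (2^m - 1) B_m^2 / (2 (m!)^2)` for even `m`, and `0` for odd `m`. -/
noncomputable def writheLambda (m : ℕ) : ℝ :=
  if Even m then
    8 ^ m * (2 ^ m - 1) * (bernoulli m : ℝ) ^ 2 / (2 * (m.factorial : ℝ) ^ 2)
  else 0

/-- The power series `∑_{m ≥ 1} (λ_m / m) z^m`; its constant coefficient is `0`. -/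
noncomputable def writheLogSeries : FormalMultilinearSeries ℂ ℂ ℂ :=
  FormalMultilinearSeries.ofScalars ℂ
    (fun m : ℕ => if m = 0 then (0 : ℂ) else ((writheLambda m / m : ℝ) : ℂ))

/-! A uniformly random permutation is the ranking of `2n+1` independent uniform heights `U i` in
`[0, 1)`, read as points of the circle. There `sign (v - u)` is a 1-periodic sawtooth of `v - u`
plus a linear term, and the linear terms cancel in the cyclic sum (`writhe_circleLift_eq`). So the
writhe is a sum of centered functions of `U (i + d) - U i`, one for each edge of the complete graph
on `2n+1` vertices, and terms on different edges are orthogonal: mean squares can be computed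
exactly (`integral_sq_cyclic_sum`).

Expand both dependences in Fourier series: the sawtooth in the heights, and the odd square wave on
`ℤ/(2n+1)`, equal to `1` at `d = 1, …, n`, in the positions. After truncating both at `T` terms, the
mean square error tends to `approxError T` as `n → ∞`, and this tends to `0` as `T → ∞`. The
truncated sum is a diagonal quadratic form in finitely many trigonometric sums (`writheApprox_eq`),
which are jointly asymptotic to independent standard Gaussians (`tendsto_trigLaw`). Each pair of
frequencies contributes four squares, two with coefficient `c/2` and two with `-c/2`, where `c = 4 /
(π² (2k+1)(l+1))`. A sum of two squared standard Gaussians is exponential, and a difference of two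
independent exponentials is Laplace, so the limit is `W = ∑ c L` with independent standard Laplace
variables `L`.

The rest concerns this explicit law. Its characteristic function is `∏ (1 + c² t²)⁻¹`. The even zeta
values give `∑ c^(2r) = λ_(2r) / 2`, so expanding the logarithms and exchanging sums produces the
stated series on the imaginary axis; analyticity carries it to the disc. The largest scale is
`4/π²`. Its Laplace factor, of rate `π²/4`, supplies the density and the lower tail bound, while
exponential moments below that rate supply the upper one. The same scale governs the growth of `λ_m`
and hence the radius of convergence. Uniqueness is the identity theorem in a strip around the
imaginary axis. -/

/-! ### The Laplace distribution -/

/-- The Laplace distribution on `ℝ` with rate `b`, of density `(b / 2) exp (-b |x|)`. -/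
noncomputable def laplaceMeasure (b : ℝ) : Measure ℝ :=
  volume.withDensity (fun x => ENNReal.ofReal (b / 2 * Real.exp (-b * |x|)))

lemma laplaceMeasure_absolutelyContinuous (b : ℝ) : laplaceMeasure b ≪ volume :=
  withDensity_absolutelyContinuous _ _

lemma integrableOn_integral_exp_neg_abs_Iic {b : ℝ} {z : ℂ} (hz : |z.re| < b) :
    IntegrableOn (fun x : ℝ => Complex.exp (z * x) * Real.exp (-b * |x|)) (Set.Iic 0) ∧
    ∫ x in Set.Iic (0 : ℝ), Complex.exp (z * x) * Real.exp (-b * |x|) = 1 / (b + z) := by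
  have h1 : 0 < (b + z : ℂ).re := by
    have := (abs_lt.1 hz).1
    simp; linarith
  have h2 : ∀ x ∈ Set.Iic (0 : ℝ),
      Complex.exp ((b + z) * x) = Complex.exp (z * x) * Real.exp (-b * |x|) := by
    intro x hx
    rw [abs_of_nonpos hx, Complex.ofReal_exp, ← Complex.exp_add]
    push_cast; ring_nf
  refine ⟨(integrableOn_exp_mul_complex_Iic h1 0).congr_fun h2 measurableSet_Iic, ?_⟩
  rw [← setIntegral_congr_fun measurableSet_Iic h2, integral_exp_mul_complex_Iic h1]
  simp

lemma integrableOn_integral_exp_neg_abs_Ioi {b : ℝ} {z : ℂ} (hz : |z.re| < b) :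
    IntegrableOn (fun x : ℝ => Complex.exp (z * x) * Real.exp (-b * |x|)) (Set.Ioi 0) ∧
    ∫ x in Set.Ioi (0 : ℝ), Complex.exp (z * x) * Real.exp (-b * |x|) = 1 / (b - z) := by
  have h1 : (z - b : ℂ).re < 0 := by
    have := (abs_lt.1 hz).2
    simp; linarith
  have h2 : ∀ x ∈ Set.Ioi (0 : ℝ),
      Complex.exp ((z - b) * x) = Complex.exp (z * x) * Real.exp (-b * |x|) := by
    intro x hx
    rw [abs_of_pos hx, Complex.ofReal_exp, ← Complex.exp_add]
    push_cast; ring_nf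
  refine ⟨(integrableOn_exp_mul_complex_Ioi h1 0).congr_fun h2 measurableSet_Ioi, ?_⟩
  rw [← setIntegral_congr_fun measurableSet_Ioi h2, integral_exp_mul_complex_Ioi h1]
  simp only [Complex.ofReal_zero, mul_zero, Complex.exp_zero]
  rw [← neg_sub (b : ℂ) z, neg_div_neg_eq]

lemma integrable_exp_mul_exp_neg_abs {b : ℝ} {z : ℂ} (hz : |z.re| < b) :
    Integrable (fun x : ℝ => Complex.exp (z * x) * Real.exp (-b * |x|)) := by
  rw [← integrableOn_univ, ← Set.Iic_union_Ioi (a := (0 : ℝ))]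
  exact (integrableOn_integral_exp_neg_abs_Iic hz).1.union
    (integrableOn_integral_exp_neg_abs_Ioi hz).1

lemma integral_exp_mul_exp_neg_abs {b : ℝ} {z : ℂ} (hz : |z.re| < b) :
    ∫ x : ℝ, Complex.exp (z * x) * Real.exp (-b * |x|) = 2 * b / (b ^ 2 - z ^ 2) := by
  have h := integrable_exp_mul_exp_neg_abs hz
  rw [← intervalIntegral.integral_Iic_add_Ioi (b := 0) h.integrableOn h.integrableOn,
    (integrableOn_integral_exp_neg_abs_Iic hz).2, (integrableOn_integral_exp_neg_abs_Ioi hz).2]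
  obtain ⟨h1, h2⟩ := abs_lt.1 hz
  have h3 : (b + z : ℂ) ≠ 0 := fun h => by
    have := congrArg Complex.re h
    simp at this; linarith
  have h4 : (b - z : ℂ) ≠ 0 := fun h => by
    have := congrArg Complex.re h
    simp at this; linarith
  have h5 : (b ^ 2 - z ^ 2 : ℂ) ≠ 0 := by
    rw [show (b ^ 2 - z ^ 2 : ℂ) = (b + z) * (b - z) by ring]; exact mul_ne_zero h3 h4
  field_simp
  ring

lemma integrable_cexp_laplaceMeasure {b : ℝ} {z : ℂ} (hz : |z.re| < b) :
    Integrable (fun x : ℝ => Complex.exp (z * x)) (laplaceMeasure b) := by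
  have hb : 0 < b := (abs_nonneg _).trans_lt hz
  rw [laplaceMeasure, integrable_withDensity_iff_integrable_smul' (by fun_prop)
    (by simp)]
  refine ((integrable_exp_mul_exp_neg_abs hz).const_mul ((b / 2 : ℝ) : ℂ)).congr (ae_of_all _ ?_)
  intro x
  simp only [Complex.real_smul]
  rw [ENNReal.toReal_ofReal (by positivity)]
  push_cast; ring

lemma integral_cexp_laplaceMeasure {b : ℝ} {z : ℂ} (hz : |z.re| < b) :
    ∫ x : ℝ, Complex.exp (z * x) ∂(laplaceMeasure b) = b ^ 2 / (b ^ 2 - z ^ 2) := by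
  have hb : 0 < b := (abs_nonneg _).trans_lt hz
  rw [laplaceMeasure, integral_withDensity_eq_integral_toReal_smul (by fun_prop) (by simp)]
  have : ∀ x : ℝ, (ENNReal.ofReal (b / 2 * Real.exp (-b * |x|))).toReal • Complex.exp (z * x) =
      ((b / 2 : ℝ) : ℂ) * (Complex.exp (z * x) * Real.exp (-b * |x|)) := by
    intro x
    simp only [Complex.real_smul]
    rw [ENNReal.toReal_ofReal (by positivity)]
    push_cast; ring
  simp_rw [this]
  rw [integral_const_mul, integral_exp_mul_exp_neg_abs hz]
  push_cast; ring

lemma isProbabilityMeasure_laplaceMeasure {b : ℝ} (hb : 0 < b) :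
    IsProbabilityMeasure (laplaceMeasure b) := by
  have h0 : |(0 : ℂ).re| < b := by simpa using hb
  have hi : Integrable (fun _ : ℝ => (1 : ℝ)) (laplaceMeasure b) := by
    simpa using (integrable_cexp_laplaceMeasure h0).norm
  have : IsFiniteMeasure (laplaceMeasure b) := by
    rw [integrable_const_iff] at hi
    simpa using hi
  have h1 := integral_cexp_laplaceMeasure h0
  have hb' : (b : ℂ) ^ 2 ≠ 0 := by exact_mod_cast (pow_pos hb 2).ne'
  simp only [zero_mul, Complex.exp_zero, integral_const, mul_one, ne_eq,
    OfNat.ofNat_ne_zero, not_false_eq_true, zero_pow, sub_zero, div_self hb',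
    Complex.real_smul] at h1
  have h2 : (laplaceMeasure b).real Set.univ = 1 := by exact_mod_cast h1
  exact ⟨by rwa [measureReal_def, ENNReal.toReal_eq_one_iff] at h2⟩

lemma charFun_laplaceMeasure {b : ℝ} (hb : 0 < b) (t : ℝ) :
    charFun (laplaceMeasure b) t = (((1 + (b⁻¹) ^ 2 * t ^ 2)⁻¹ : ℝ) : ℂ) := by
  rw [charFun_apply_real]
  have h0 : |((t : ℂ) * Complex.I).re| < b := by simpa using hb
  have h := integral_cexp_laplaceMeasure h0
  have : ∀ x : ℝ, (t : ℂ) * x * Complex.I = t * Complex.I * x := fun x => by ring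
  simp_rw [this, h]
  have h1 : (b ^ 2 + t ^ 2 : ℂ) ≠ 0 := by exact_mod_cast (by positivity : b ^ 2 + t ^ 2 ≠ 0)
  have hb' : (b : ℂ) ≠ 0 := by exact_mod_cast hb.ne'
  have h2 : (b ^ 2 - (t * Complex.I) ^ 2 : ℂ) = b ^ 2 + t ^ 2 := by
    rw [mul_pow, Complex.I_sq]; ring
  rw [h2]
  push_cast
  rw [eq_comm, inv_eq_iff_eq_inv, inv_div]
  field_simp

/-- Exponential moments are kept as lower Lebesgue integrals: these multiply under convolution and
pass to weak limits by Fatou with no prior integrability. -/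
lemma lintegral_exp_laplaceMeasure {b z : ℝ} (hz : |z| < b) :
    ∫⁻ x : ℝ, ENNReal.ofReal (Real.exp (z * x)) ∂(laplaceMeasure b) =
      ENNReal.ofReal ((1 - (b⁻¹) ^ 2 * z ^ 2)⁻¹) := by
  have h0 : |(z : ℂ).re| < b := by simpa using hz
  have hb : 0 < b := (abs_nonneg _).trans_lt hz
  have hi : Integrable (fun x : ℝ => Real.exp (z * x)) (laplaceMeasure b) := by
    simpa [Complex.norm_exp] using (integrable_cexp_laplaceMeasure h0).norm
  rw [← ofReal_integral_eq_lintegral_ofReal hi (ae_of_all _ fun x => (Real.exp_pos _).le)]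
  congr 1
  have h := integral_cexp_laplaceMeasure h0
  have h1 : ∫ x : ℝ, Real.exp (z * x) ∂(laplaceMeasure b) = b ^ 2 / (b ^ 2 - z ^ 2) := by
    have h3 : ((∫ x : ℝ, Real.exp (z * x) ∂(laplaceMeasure b) : ℝ) : ℂ) =
        ((b ^ 2 / (b ^ 2 - z ^ 2) : ℝ) : ℂ) := by
      rw [← integral_complex_ofReal]
      push_cast
      exact h
    exact_mod_cast h3
  have h2 : b ^ 2 - z ^ 2 ≠ 0 := by
    have : z ^ 2 < b ^ 2 := sq_lt_sq.2 (by rwa [abs_of_pos hb])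
    linarith
  rw [h1, eq_comm, inv_eq_iff_eq_inv, inv_div]
  field_simp

lemma laplaceMeasure_Ioi {b t : ℝ} (hb : 0 < b) (ht : 0 ≤ t) :
    (laplaceMeasure b).real (Set.Ioi t) = Real.exp (-b * t) / 2 := by
  rw [measureReal_def, laplaceMeasure, withDensity_apply _ measurableSet_Ioi]
  have h1 : IntegrableOn (fun x : ℝ => b / 2 * Real.exp (-b * |x|)) (Set.Ioi t) := by
    refine (Integrable.const_mul ?_ _).integrableOn
    have := (integrable_exp_mul_exp_neg_abs (b := b) (z := 0) (by simpa using hb)).norm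
    simpa [Complex.norm_exp] using this
  rw [← ofReal_integral_eq_lintegral_ofReal h1 (ae_of_all _ fun x => by positivity),
    ENNReal.toReal_ofReal (integral_nonneg fun x => by positivity), integral_const_mul]
  have h2 : ∀ x ∈ Set.Ioi t, Real.exp (-b * |x|) = Real.exp (-b * x) := fun x hx => by
    rw [abs_of_pos (ht.trans_lt hx)]
  rw [setIntegral_congr_fun measurableSet_Ioi h2, integral_exp_mul_Ioi (by linarith)]
  field_simp

/-! ### Limits of characteristic functions -/

/-- **Lévy's continuity theorem**, existence form: a pointwise limit of characteristic functions
which is continuous at `0` is the characteristic function of the weak limit. -/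
theorem exists_tendsto_of_tendsto_charFun {μ : ℕ → ProbabilityMeasure ℝ} {f : ℝ → ℂ}
    (hf : ContinuousAt f 0)
    (h : ∀ t, Tendsto (fun n => charFun (μ n : Measure ℝ) t) atTop (𝓝 (f t))) :
    ∃ ν : ProbabilityMeasure ℝ, Tendsto μ atTop (𝓝 ν) ∧ ∀ t, charFun (ν : Measure ℝ) t = f t := by
  -- Continuity of `f` at `0` rules out escape of mass. Prokhorov's theorem then gives a
  -- subsequential limit; its characteristic function is `f`, which upgrades to convergence of the
  -- whole sequence.
  have htight := isTightMeasureSet_of_tendsto_charFun (μ := fun n => (μ n : Measure ℝ)) hf h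
  have hS : {x : Measure ℝ | ∃ ν ∈ Set.range μ, ((ν : ProbabilityMeasure ℝ) : Measure ℝ) = x} =
      Set.range fun n => (μ n : Measure ℝ) := by
    ext x; simp
  have hc := isCompact_closure_of_isTightMeasureSet (S := Set.range μ) (by rwa [hS])
  obtain ⟨ν, -, φ, hφ, hν⟩ := hc.tendsto_subseq (x := μ) fun n => subset_closure ⟨n, rfl⟩
  have hch : ∀ t, charFun (ν : Measure ℝ) t = f t := fun t =>
    tendsto_nhds_unique (ProbabilityMeasure.tendsto_iff_tendsto_charFun.1 hν t)
      ((h t).comp hφ.tendsto_atTop)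
  refine ⟨ν, ProbabilityMeasure.tendsto_of_tendsto_charFun fun t => ?_, hch⟩
  rw [hch]; exact h t

/-! ### Sums of independent Laplace variables -/

lemma lintegral_exp_conv (μ ν : Measure ℝ) [SFinite ν] (z : ℝ) :
    ∫⁻ x, ENNReal.ofReal (Real.exp (z * x)) ∂(μ ∗ ν) =
      (∫⁻ x, ENNReal.ofReal (Real.exp (z * x)) ∂μ) *
        ∫⁻ x, ENNReal.ofReal (Real.exp (z * x)) ∂ν := by
  rw [Measure.lintegral_conv (by fun_prop)]
  simp_rw [mul_add, Real.exp_add, ENNReal.ofReal_mul (Real.exp_pos _).le]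
  simp_rw [lintegral_const_mul _ (show Measurable fun y : ℝ => ENNReal.ofReal (Real.exp (z * y)) by
    fun_prop)]
  rw [lintegral_mul_const _ (by fun_prop)]

/-- The law of the partial sum of `c i * L i` over `i < n`, built by repeated convolution; a
variable of scale `c i` is Laplace of rate `(c i)⁻¹`. -/
lemma exists_charFun_eq_prod_range (c : ℕ → ℝ) (hc : ∀ i, 0 < c i) (n : ℕ) :
    ∃ μ : ProbabilityMeasure ℝ,
      (∀ t, charFun (μ : Measure ℝ) t =
        ((∏ i ∈ Finset.range n, (1 + c i ^ 2 * t ^ 2)⁻¹ : ℝ) : ℂ)) ∧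
      ∀ z : ℝ, (∀ i, c i * |z| < 1) →
        ∫⁻ x, ENNReal.ofReal (Real.exp (z * x)) ∂(μ : Measure ℝ) =
          ENNReal.ofReal (∏ i ∈ Finset.range n, (1 - c i ^ 2 * z ^ 2)⁻¹) := by
  induction n with
  | zero => exact ⟨⟨Measure.dirac 0, inferInstance⟩, by simp, by simp⟩
  | succ n ih =>
    obtain ⟨μ, h1, h2⟩ := ih
    have hb : 0 < (c n)⁻¹ := inv_pos.2 (hc n)
    have := isProbabilityMeasure_laplaceMeasure hb
    refine ⟨⟨(μ : Measure ℝ) ∗ laplaceMeasure (c n)⁻¹, inferInstance⟩, fun t => ?_, fun z hz => ?_⟩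
    · rw [ProbabilityMeasure.coe_mk, charFun_conv, h1, charFun_laplaceMeasure hb, inv_inv,
        Finset.prod_range_succ]
      push_cast; rfl
    · have hz' : |z| < (c n)⁻¹ := by
        rw [← one_div, lt_div_iff₀ (hc n), mul_comm]; exact hz n
      rw [ProbabilityMeasure.coe_mk, lintegral_exp_conv, h2 z hz, lintegral_exp_laplaceMeasure hz',
        inv_inv, Finset.prod_range_succ, ENNReal.ofReal_mul]
      refine Finset.prod_nonneg fun i _ => inv_nonneg.2 ?_
      have h3 : (c i * |z|) ^ 2 ≤ 1 := pow_le_one₀ (mul_nonneg (hc i).le (abs_nonneg z)) (hz i).le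
      rw [mul_pow, sq_abs] at h3
      linarith

lemma summable_log_one_add_sq_mul {c : ℕ → ℝ} (hs : Summable fun i => c i ^ 2) (t : ℝ) :
    Summable fun i => Real.log (1 + c i ^ 2 * t ^ 2) :=
  Real.summable_log_one_add_of_summable (hs.mul_right _)

/-- The inequality `log (1 + x) ≤ x` bounds the exponent by `(∑ c i ^ 2) * t ^ 2`. -/
lemma continuousAt_exp_neg_tsum_log {c : ℕ → ℝ} (hs : Summable fun i => c i ^ 2) :
    ContinuousAt (fun t : ℝ =>
      ((Real.exp (-∑' i, Real.log (1 + c i ^ 2 * t ^ 2)) : ℝ) : ℂ)) 0 := by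
  refine Complex.continuous_ofReal.continuousAt.comp (Real.continuous_exp.continuousAt.comp
    (ContinuousAt.neg ?_))
  rw [ContinuousAt]
  have h0 : ∑' i, Real.log (1 + c i ^ 2 * (0 : ℝ) ^ 2) = 0 := by simp
  rw [h0]
  have h1 : Tendsto (fun t : ℝ => (∑' i, c i ^ 2) * t ^ 2) (𝓝 0) (𝓝 0) := by
    have : Continuous fun t : ℝ => (∑' i, c i ^ 2) * t ^ 2 := by fun_prop
    simpa using this.tendsto 0
  refine squeeze_zero (fun t => tsum_nonneg fun i => Real.log_nonneg ?_) (fun t => ?_) h1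
  · nlinarith [mul_nonneg (sq_nonneg (c i)) (sq_nonneg t)]
  · rw [← tsum_mul_right]
    refine (summable_log_one_add_sq_mul hs t).tsum_le_tsum (fun i => ?_) (hs.mul_right _)
    have h2 : 0 < 1 + c i ^ 2 * t ^ 2 := by positivity
    linarith [Real.log_le_sub_one_of_pos h2]

/-- For a square summable sequence `c` of positive reals, the law of `∑ c i * L i` with independent
standard Laplace variables `L i`. -/
theorem exists_laplace_series (c : ℕ → ℝ) (hc : ∀ i, 0 < c i) (hs : Summable fun i => c i ^ 2) :
    ∃ μ : ProbabilityMeasure ℝ,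
      (∀ t, charFun (μ : Measure ℝ) t =
        ((Real.exp (-∑' i, Real.log (1 + c i ^ 2 * t ^ 2)) : ℝ) : ℂ)) ∧
      ∀ z : ℝ, (∀ i, c i * |z| < 1) →
        Integrable (fun x => Real.exp (z * x)) (μ : Measure ℝ) := by
  choose μ hμ1 hμ2 using exists_charFun_eq_prod_range c hc
  obtain ⟨ν, hν, hch⟩ := exists_tendsto_of_tendsto_charFun (μ := μ)
    (continuousAt_exp_neg_tsum_log hs) (fun t => by
      simp_rw [hμ1]
      refine (Complex.continuous_ofReal.tendsto _).comp ?_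
      have h1 := (summable_log_one_add_sq_mul hs t).hasSum.tendsto_sum_nat.neg
      refine ((Real.continuous_exp.tendsto _).comp h1).congr fun n => ?_
      rw [Function.comp_apply, ← Finset.sum_neg_distrib, Real.exp_sum]
      refine Finset.prod_congr rfl fun i _ => ?_
      rw [← Real.log_inv, Real.exp_log (by positivity)])
  refine ⟨ν, hch, fun z hz => ?_⟩
  have hpos : ∀ i, 0 < 1 - c i ^ 2 * z ^ 2 := fun i => by
    have h3 : (c i * |z|) ^ 2 < 1 :=
      pow_lt_one₀ (mul_nonneg (hc i).le (abs_nonneg z)) (hz i) two_ne_zero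
    rw [mul_pow, sq_abs] at h3
    linarith
  have hls : Summable fun i => -Real.log (1 - c i ^ 2 * z ^ 2) := by
    have := (Real.summable_log_one_add_of_summable (hs.mul_right (z ^ 2)).neg).neg
    simpa [sub_eq_add_neg] using this
  -- The factors `(1 - c i ^ 2 * z ^ 2)⁻¹` are at least `1`, so the full product bounds every
  -- partial one.
  have hbound : ∀ n, ∫⁻ x, ENNReal.ofReal (Real.exp (z * x)) ∂(μ n : Measure ℝ) ≤
      ENNReal.ofReal (Real.exp (∑' i, -Real.log (1 - c i ^ 2 * z ^ 2))) := fun n => by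
    rw [hμ2 n z hz]
    refine ENNReal.ofReal_le_ofReal ?_
    have : ∏ i ∈ Finset.range n, (1 - c i ^ 2 * z ^ 2)⁻¹ =
        Real.exp (∑ i ∈ Finset.range n, -Real.log (1 - c i ^ 2 * z ^ 2)) := by
      rw [Real.exp_sum]
      refine Finset.prod_congr rfl fun i _ => ?_
      rw [← Real.log_inv, Real.exp_log (inv_pos.2 (hpos i))]
    rw [this]
    refine Real.exp_le_exp.2 (hls.sum_le_tsum _ fun i _ => ?_)
    refine neg_nonneg.2 (Real.log_nonpos (hpos i).le ?_)
    linarith [mul_nonneg (sq_nonneg (c i)) (sq_nonneg z)]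
  -- Fatou's lemma for weak convergence, applied to the unbounded but nonnegative and continuous
  -- function `exp (z x)`.
  have hfat := lintegral_le_liminf_lintegral_of_forall_isOpen_measure_le_liminf_measure
    (μ := (ν : Measure ℝ)) (μs := fun n => (μ n : Measure ℝ)) (f := fun x => Real.exp (z * x))
    (by fun_prop) (fun x => (Real.exp_pos _).le)
    (fun G hG => ProbabilityMeasure.le_liminf_measure_open_of_tendsto hν hG)
  have hfin : ∫⁻ x, ENNReal.ofReal (Real.exp (z * x)) ∂(ν : Measure ℝ) < ⊤ :=
    (hfat.trans (liminf_le_of_le (by isBoundedDefault) fun b hb => by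
      obtain ⟨n, hn⟩ := hb.exists
      exact hn.trans (hbound n))).trans_lt ENNReal.ofReal_lt_top
  refine ⟨by fun_prop, ?_⟩
  rw [hasFiniteIntegral_iff_ofReal (ae_of_all _ fun x => (Real.exp_pos _).le)]
  exact hfin

/-! ### Exponential tails -/

/-- Chernoff's bound at each `z < b` controls the tail from above, `hlower` from below;
multiplicative constants disappear after taking logarithms and dividing by `t`. -/
lemma tendsto_log_tail_of_bounds {μ : Measure ℝ} [IsProbabilityMeasure μ] {b C : ℝ} (hb : 0 < b)
    (hC : 0 < C)
    (hupper : ∀ z : ℝ, |z| < b → Integrable (fun x => Real.exp (z * x)) μ)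
    (hlower : ∀ t : ℝ, 0 ≤ t → C * Real.exp (-b * t) ≤ μ.real {x : ℝ | t < |x|}) :
    Tendsto (fun t : ℝ => (1 / t) * Real.log (μ.real {x : ℝ | t < |x|})) atTop (𝓝 (-b)) := by
  refine tendsto_order.2 ⟨fun a ha => ?_, fun a ha => ?_⟩
  · have h1 : Tendsto (fun t : ℝ => (1 / t) * Real.log C + -b) atTop (𝓝 (0 * Real.log C + -b)) :=
      ((tendsto_const_nhds.div_atTop tendsto_id).mul_const _).add_const _
    rw [zero_mul, zero_add] at h1
    filter_upwards [h1.eventually (lt_mem_nhds ha), eventually_gt_atTop 0] with t ht ht0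
    refine ht.trans_le ?_
    have h2 := Real.log_le_log (by positivity) (hlower t ht0.le)
    rw [Real.log_mul hC.ne' (Real.exp_pos _).ne', Real.log_exp] at h2
    have h3 : (1 / t) * Real.log C + -b = (1 / t) * (Real.log C + -b * t) := by field_simp
    rw [h3]
    exact mul_le_mul_of_nonneg_left h2 (by positivity)
  -- A Chernoff exponent `z` with `-z < a`; the maximum with `0` keeps it positive when `a` is
  -- nonnegative.
  · obtain ⟨z, hz1, hz2⟩ : ∃ z, max (-a) 0 < z ∧ z < b := exists_between (max_lt (by linarith) hb)
    have hz0 : 0 < z := (le_max_right _ _).trans_lt hz1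
    have hza : -z < a := by linarith [(le_max_left (-a) 0).trans_lt hz1]
    have hi1 := hupper z (by rwa [abs_of_pos hz0])
    have hi2 := hupper (-z) (by rwa [abs_neg, abs_of_pos hz0])
    set K := ∫ x, (Real.exp (z * x) + Real.exp (-z * x)) ∂μ with hK
    have hmarkov : ∀ t, μ.real {x : ℝ | t < |x|} ≤ Real.exp (-z * t) * K := fun t => by
      have h4 : μ.real {x : ℝ | t < |x|} ≤
          μ.real {x | Real.exp (z * t) ≤ Real.exp (z * x) + Real.exp (-z * x)} := by
        refine measureReal_mono fun x hx => ?_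
        simp only [Set.mem_ofPred_eq] at hx ⊢
        rcases abs_cases x with ⟨h, _⟩ | ⟨h, _⟩ <;> rw [h] at hx
        · linarith [Real.exp_le_exp.2 (mul_le_mul_of_nonneg_left hx.le hz0.le),
            Real.exp_pos (-z * x)]
        · have := Real.exp_le_exp.2 (mul_le_mul_of_nonneg_left hx.le hz0.le)
          rw [show z * -x = -z * x by ring] at this
          linarith [Real.exp_pos (z * x)]
      have h5 := mul_meas_ge_le_integral_of_nonneg (μ := μ)
        (ae_of_all _ fun x => (by positivity : 0 ≤ Real.exp (z * x) + Real.exp (-z * x)))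
        (hi1.add hi2) (Real.exp (z * t))
      rw [neg_mul, Real.exp_neg, inv_mul_eq_div, le_div_iff₀ (Real.exp_pos _), mul_comm]
      exact (mul_le_mul_of_nonneg_left h4 (Real.exp_pos _).le).trans h5
    have hK0 : 0 < K := by
      have h6 := hmarkov 0
      have h7 := hlower 0 le_rfl
      simp only [mul_zero, Real.exp_zero, one_mul, mul_one] at h6 h7
      linarith
    have h1 : Tendsto (fun t : ℝ => (1 / t) * Real.log K + -z) atTop (𝓝 (0 * Real.log K + -z)) :=
      ((tendsto_const_nhds.div_atTop tendsto_id).mul_const _).add_const _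
    rw [zero_mul, zero_add] at h1
    filter_upwards [h1.eventually (gt_mem_nhds hza), eventually_gt_atTop 0] with t ht ht0
    refine lt_of_le_of_lt ?_ ht
    have hpos : 0 < μ.real {x : ℝ | t < |x|} := lt_of_lt_of_le (by positivity) (hlower t ht0.le)
    have h2 := Real.log_le_log hpos (hmarkov t)
    rw [Real.log_mul (Real.exp_pos _).ne' hK0.ne', Real.log_exp] at h2
    have h3 : (1 / t) * Real.log K + -z = (1 / t) * (-z * t + Real.log K) := by field_simp; ring
    rw [h3]
    exact mul_le_mul_of_nonneg_left h2 (by positivity)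

/-- If the `ν` component is at least `-a` and the Laplace component exceeds `t + a`, the sum exceeds
`t`. Any `a` with `ν [-a, ∞) > 0` works, at the cost of the constant factor `exp (-b a) / 2`. -/
lemma exists_tail_laplace_conv (b : ℝ) (hb : 0 < b) (ν : Measure ℝ) [IsProbabilityMeasure ν] :
    ∃ C > 0, ∀ t : ℝ, 0 ≤ t →
      C * Real.exp (-b * t) ≤ (ν ∗ laplaceMeasure b).real {x : ℝ | t < |x|} := by
  have := isProbabilityMeasure_laplaceMeasure hb
  obtain ⟨a, ha0, ha⟩ : ∃ a : ℝ, 0 ≤ a ∧ 0 < ν.real (Set.Ici (-a)) := by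
    have h1 : Tendsto (fun n : ℕ => ν (Set.Ici (-(n : ℝ)))) atTop
        (𝓝 (ν (⋃ n : ℕ, Set.Ici (-(n : ℝ))))) := by
      refine tendsto_measure_iUnion_atTop fun m n hmn => Set.Ici_subset_Ici.2 ?_
      simpa using hmn
    have h2 : ⋃ n : ℕ, Set.Ici (-(n : ℝ)) = Set.univ := by
      refine Set.eq_univ_of_forall fun x => ?_
      obtain ⟨n, hn⟩ := exists_nat_ge (-x)
      exact Set.mem_iUnion.2 ⟨n, by simp only [Set.mem_Ici]; linarith⟩
    rw [h2, measure_univ] at h1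
    obtain ⟨n, hn⟩ := (h1.eventually (lt_mem_nhds zero_lt_one)).exists
    exact ⟨n, n.cast_nonneg, ENNReal.toReal_pos hn.ne' (measure_ne_top _ _)⟩
  refine ⟨ν.real (Set.Ici (-a)) * (Real.exp (-b * a) / 2), by positivity, fun t ht => ?_⟩
  have h3 : ν.real (Set.Ici (-a)) * (laplaceMeasure b).real (Set.Ioi (t + a)) ≤
      (ν ∗ laplaceMeasure b).real {x : ℝ | t < |x|} := by
    rw [← measureReal_prod_prod, Measure.conv, map_measureReal_apply (by fun_prop)
      (measurableSet_lt measurable_const (by fun_prop))]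
    refine measureReal_mono fun p hp => ?_
    simp only [Set.mem_prod, Set.mem_Ici, Set.mem_Ioi, Set.mem_preimage, Set.mem_ofPred_eq] at hp ⊢
    exact lt_of_lt_of_le (by linarith) (le_abs_self _)
  rw [laplaceMeasure_Ioi hb (by linarith)] at h3
  refine le_trans (le_of_eq ?_) h3
  rw [mul_add, Real.exp_add]; ring

/-! ### The coefficients of the limit law -/

/-- The scale `4 / (π² (2 a + 1) (b + 1))` of a Laplace component of the limit law. -/
noncomputable def laplaceScale (p : ℕ × ℕ) : ℝ :=
  4 / (Real.pi ^ 2 * (2 * p.1 + 1) * (p.2 + 1))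

/-- The scales `laplaceScale`, enumerated along `Nat.unpair`. -/
noncomputable def laplaceScaleSeq (i : ℕ) : ℝ := laplaceScale i.unpair

lemma laplaceScale_pos (p : ℕ × ℕ) : 0 < laplaceScale p := by
  unfold laplaceScale; positivity

lemma laplaceScale_le (p : ℕ × ℕ) : laplaceScale p ≤ 4 / Real.pi ^ 2 := by
  unfold laplaceScale
  refine div_le_div_of_nonneg_left (by norm_num) (by positivity) ?_
  rw [mul_assoc]
  refine le_mul_of_one_le_right (by positivity) ?_
  nlinarith [(Nat.cast_nonneg p.1 : (0 : ℝ) ≤ p.1), (Nat.cast_nonneg p.2 : (0 : ℝ) ≤ p.2),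
    mul_nonneg (Nat.cast_nonneg p.1 : (0 : ℝ) ≤ p.1) (Nat.cast_nonneg p.2 : (0 : ℝ) ≤ p.2)]

lemma laplaceScaleSeq_zero : laplaceScaleSeq 0 = 4 / Real.pi ^ 2 := by
  simp [laplaceScaleSeq, laplaceScale]

/-- Euler's formula for `ζ(2r)`. The sum is nonnegative, so the alternating sign can be absorbed
into `|bernoulli (2 * r)|`. -/
lemma hasSum_one_div_add_one_pow {r : ℕ} (hr : r ≠ 0) :
    HasSum (fun n : ℕ => (1 : ℝ) / ((n : ℝ) + 1) ^ (2 * r))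
      ((2 * Real.pi) ^ (2 * r) * |(bernoulli (2 * r) : ℝ)| / (2 * (2 * r).factorial)) := by
  have h := hasSum_zeta_nat hr
  set v := (-1 : ℝ) ^ (r + 1) * 2 ^ (2 * r - 1) * Real.pi ^ (2 * r) * (bernoulli (2 * r) : ℝ) /
    (2 * r).factorial with hv
  have hv0 : 0 ≤ v := h.nonneg fun n => by positivity
  have h1 : v = (2 * Real.pi) ^ (2 * r) * |(bernoulli (2 * r) : ℝ)| / (2 * (2 * r).factorial) := by
    rw [← abs_of_nonneg hv0, hv]
    simp only [abs_div, abs_mul, abs_pow, abs_neg, abs_one, one_pow, one_mul, Nat.abs_cast,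
      abs_of_pos Real.pi_pos, Nat.abs_ofNat]
    obtain ⟨k, rfl⟩ : ∃ k, r = k + 1 := ⟨r - 1, by omega⟩
    rw [show 2 * (k + 1) - 1 = 2 * k + 1 by omega, show 2 * (k + 1) = 2 * k + 1 + 1 by ring,
      mul_pow, pow_succ (2 : ℝ) (2 * k + 1)]
    field_simp
  rw [← h1]
  have h2 := (hasSum_nat_add_iff' (f := fun n : ℕ => (1 : ℝ) / (n : ℝ) ^ (2 * r)) 1).2 h
  simpa [hr] using h2

/-- The terms with even denominator `2 (n + 1)` contribute `v / 2 ^ k`; what remains is the sum over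
odd denominators. -/
lemma hasSum_one_div_odd_pow_of_hasSum {k : ℕ} {v : ℝ}
    (h : HasSum (fun n : ℕ => (1 : ℝ) / ((n : ℝ) + 1) ^ k) v) :
    HasSum (fun n : ℕ => (1 : ℝ) / (2 * (n : ℝ) + 1) ^ k) ((1 - 1 / 2 ^ k) * v) := by
  have hodd : HasSum (fun n : ℕ => (1 : ℝ) / (((2 * n + 1 : ℕ) : ℝ) + 1) ^ k)
      (1 / 2 ^ k * v) := by
    have h1 : (fun n : ℕ => (1 : ℝ) / (((2 * n + 1 : ℕ) : ℝ) + 1) ^ k) =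
        fun n : ℕ => 1 / 2 ^ k * ((1 : ℝ) / ((n : ℝ) + 1) ^ k) := by
      funext n
      rw [div_mul_div_comm, one_mul, ← mul_pow]
      push_cast
      ring_nf
    rw [h1]
    exact h.mul_left _
  have hs : Summable (fun n : ℕ => (1 : ℝ) / (((2 * n : ℕ) : ℝ) + 1) ^ k) :=
    Summable.comp_injective (f := fun n : ℕ => (1 : ℝ) / ((n : ℝ) + 1) ^ k) h.summable
      (i := fun n : ℕ => 2 * n) fun a b hab => Nat.eq_of_mul_eq_mul_left two_pos hab
  have h2 := (HasSum.even_add_odd (f := fun n : ℕ => (1 : ℝ) / ((n : ℝ) + 1) ^ k) hs.hasSum hodd).unique h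
  have h3 : ∑' n : ℕ, (1 : ℝ) / (((2 * n : ℕ) : ℝ) + 1) ^ k = (1 - 1 / 2 ^ k) * v := by
    linarith
  rw [← h3]
  simpa only [Nat.cast_mul, Nat.cast_ofNat] using hs.hasSum

lemma hasSum_one_div_odd_pow {r : ℕ} (hr : r ≠ 0) :
    HasSum (fun n : ℕ => (1 : ℝ) / (2 * (n : ℝ) + 1) ^ (2 * r))
      ((1 - 1 / 2 ^ (2 * r)) *
        ((2 * Real.pi) ^ (2 * r) * |(bernoulli (2 * r) : ℝ)| / (2 * (2 * r).factorial))) :=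
  hasSum_one_div_odd_pow_of_hasSum (hasSum_one_div_add_one_pow hr)

/-- Splits `λ` into the zeta sum over odd integers times the zeta sum over all positive integers;
this product structure is why the scales are indexed by pairs. -/
lemma writheLambda_two_mul {r : ℕ} :
    writheLambda (2 * r) = 2 * ((4 / Real.pi ^ 2) ^ (2 * r) * ((1 - 1 / 2 ^ (2 * r)) *
        ((2 * Real.pi) ^ (2 * r) * |(bernoulli (2 * r) : ℝ)| / (2 * (2 * r).factorial))) *
        ((2 * Real.pi) ^ (2 * r) * |(bernoulli (2 * r) : ℝ)| / (2 * (2 * r).factorial))) := by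
  have hpi := Real.pi_ne_zero
  have h8 : (8 : ℝ) ^ (2 * r) = 4 ^ (2 * r) * 2 ^ (2 * r) := by rw [← mul_pow]; norm_num
  rw [writheLambda, if_pos (even_two_mul r), ← sq_abs (bernoulli (2 * r) : ℝ), h8, div_pow, mul_pow,
    ← pow_mul Real.pi 2, mul_comm 2 (2 * r), pow_mul Real.pi (2 * r) 2]
  field_simp

lemma hasSum_laplaceScale_pow {r : ℕ} (hr : r ≠ 0) :
    HasSum (fun p : ℕ × ℕ => laplaceScale p ^ (2 * r)) (writheLambda (2 * r) / 2) := by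
  have h1 := (hasSum_one_div_odd_pow hr).mul_left ((4 / Real.pi ^ 2) ^ (2 * r))
  have h2 := hasSum_one_div_add_one_pow hr
  have h3 := h1.mul h2 (h1.summable.mul_of_nonneg h2.summable (fun n => by positivity)
    (fun n => by positivity))
  rw [writheLambda_two_mul, mul_div_cancel_left₀ _ two_ne_zero]
  have h4 : (fun p : ℕ × ℕ => laplaceScale p ^ (2 * r)) = fun p : ℕ × ℕ =>
      (4 / Real.pi ^ 2) ^ (2 * r) * (1 / (2 * (p.1 : ℝ) + 1) ^ (2 * r)) *
        (1 / ((p.2 : ℝ) + 1) ^ (2 * r)) := by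
    funext p
    rw [laplaceScale, ← one_div_pow, ← one_div_pow, ← mul_pow, ← mul_pow]
    congr 1
    field_simp
  rw [h4]
  exact h3

lemma hasSum_laplaceScaleSeq_pow {r : ℕ} (hr : r ≠ 0) :
    HasSum (fun i => laplaceScaleSeq i ^ (2 * r)) (writheLambda (2 * r) / 2) :=
  (Nat.pairEquiv.symm.hasSum_iff (f := fun p => laplaceScale p ^ (2 * r))).2
    (hasSum_laplaceScale_pow hr)

lemma summable_laplaceScaleSeq_sq : Summable fun i => laplaceScaleSeq i ^ 2 :=
  (hasSum_laplaceScaleSeq_pow one_ne_zero).summable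

lemma writheLambda_nonneg (m : ℕ) : 0 ≤ writheLambda m := by
  rw [writheLambda]
  split_ifs
  · have : (1 : ℝ) ≤ 2 ^ m := one_le_pow₀ (by norm_num)
    have h2 : (0 : ℝ) ≤ 2 ^ m - 1 := by linarith
    positivity
  · exact le_rfl

/-- Keeps only the largest scale, at index `0`; this growth prevents a larger radius of convergence.
-/
lemma le_writheLambda_two_mul {r : ℕ} (hr : r ≠ 0) :
    2 * (4 / Real.pi ^ 2) ^ (2 * r) ≤ writheLambda (2 * r) := by
  have h := hasSum_laplaceScaleSeq_pow hr
  have h1 := h.summable.le_tsum 0 fun i _ => by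
    have := laplaceScale_pos i.unpair
    unfold laplaceScaleSeq
    positivity
  rw [h.tsum_eq, laplaceScaleSeq_zero] at h1
  linarith

/-- All but two of the factors of `c i ^ (2 * r)` are bounded by the largest scale, leaving the
convergent sum of squares. -/
lemma writheLambda_two_mul_le {r : ℕ} (hr : r ≠ 0) :
    writheLambda (2 * r) ≤ writheLambda 2 * (4 / Real.pi ^ 2) ^ (2 * r - 2) := by
  have h := hasSum_laplaceScaleSeq_pow hr
  have h1 := (hasSum_laplaceScaleSeq_pow one_ne_zero).mul_right ((4 / Real.pi ^ 2) ^ (2 * r - 2))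
  have h2 := hasSum_le (fun i => ?_) h h1
  · rw [mul_one] at h2
    linarith
  · have h3 : 2 * r = 2 * 1 + (2 * r - 2) := by omega
    conv_lhs => rw [h3, pow_add]
    have h4 := laplaceScale_pos i.unpair
    refine mul_le_mul_of_nonneg_left ?_ (by unfold laplaceScaleSeq; positivity)
    exact pow_le_pow_left₀ h4.le (laplaceScale_le _) _

lemma writheLambda_le {m : ℕ} (hm : m ≠ 0) :
    writheLambda m ≤ writheLambda 2 / (4 / Real.pi ^ 2) ^ 2 * (4 / Real.pi ^ 2) ^ m := by
  have h0 := writheLambda_nonneg 2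
  rcases Nat.even_or_odd' m with ⟨r, rfl | rfl⟩
  · have hr : r ≠ 0 := by rintro rfl; simp at hm
    refine (writheLambda_two_mul_le hr).trans (le_of_eq ?_)
    have h3 : 2 * r = 2 + (2 * r - 2) := by omega
    conv_rhs => rw [h3, pow_add]
    field_simp
  · have h1 : writheLambda (2 * r + 1) = 0 := by
      rw [writheLambda, if_neg (by simp)]
    rw [h1]; positivity

/-! ### Convergence and radius of the logarithmic power series. -/

lemma four_div_pi_sq_mul_lt_one {x : ℝ} (hx : x < Real.pi ^ 2 / 4) :
    4 / Real.pi ^ 2 * x < 1 := by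
  have : 0 < Real.pi ^ 2 := by positivity
  rw [div_mul_eq_mul_div, div_lt_one this]; linarith

lemma summable_writheLambda_mul_pow {x : ℝ} (hx0 : 0 ≤ x) (hx : x < Real.pi ^ 2 / 4) :
    Summable fun m : ℕ => writheLambda (m + 1) * x ^ (m + 1) := by
  have h1 : Summable fun m : ℕ => writheLambda 2 / (4 / Real.pi ^ 2) ^ 2 *
      (4 / Real.pi ^ 2 * x) ^ (m + 1) :=
    (((summable_geometric_of_lt_one (by positivity)
      (four_div_pi_sq_mul_lt_one hx)).comp_injective (add_left_injective 1))).mul_left _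
  refine h1.of_nonneg_of_le (fun m => mul_nonneg (writheLambda_nonneg _) (by positivity))
    fun m => ?_
  rw [mul_pow, ← mul_assoc]
  exact mul_le_mul_of_nonneg_right (writheLambda_le m.succ_ne_zero) (by positivity)

/-- The coefficients `λ_m / m`, extended by `0` at `m = 0`. -/
noncomputable def logCoeff (m : ℕ) : ℝ := if m = 0 then 0 else writheLambda m / m

lemma logCoeff_nonneg (m : ℕ) : 0 ≤ logCoeff m := by
  unfold logCoeff
  split_ifs
  · exact le_rfl
  · exact div_nonneg (writheLambda_nonneg m) m.cast_nonneg

lemma logCoeff_succ (m : ℕ) : logCoeff (m + 1) = writheLambda (m + 1) / ((m + 1 : ℕ) : ℝ) := by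
  simp [logCoeff]

lemma writheLogSeries_eq :
    writheLogSeries = FormalMultilinearSeries.ofScalars ℂ (fun m => (logCoeff m : ℂ)) := by
  unfold writheLogSeries
  congr 1
  funext m
  unfold logCoeff
  split_ifs <;> simp

lemma summable_logCoeff_mul_pow {x : ℝ} (hx0 : 0 ≤ x) (hx : x < Real.pi ^ 2 / 4) :
    Summable fun m : ℕ => logCoeff m * x ^ m := by
  rw [← summable_nat_add_iff 1]
  refine (summable_writheLambda_mul_pow hx0 hx).of_nonneg_of_le
    (fun m => mul_nonneg (logCoeff_nonneg _) (by positivity)) fun m => ?_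
  rw [logCoeff_succ]
  refine mul_le_mul_of_nonneg_right (div_le_self (writheLambda_nonneg _) ?_) (by positivity)
  simp

lemma radius_writheLogSeries : writheLogSeries.radius = ENNReal.ofReal (Real.pi ^ 2 / 4) := by
  rw [writheLogSeries_eq]
  have hnorm : ∀ n : ℕ, ‖FormalMultilinearSeries.ofScalars ℂ (fun m => (logCoeff m : ℂ)) n‖ =
      logCoeff n := fun n => by
    rw [FormalMultilinearSeries.ofScalars_norm]
    simp [abs_of_nonneg (logCoeff_nonneg n)]
  refine le_antisymm (ENNReal.le_of_forall_nnreal_lt fun r hr => ?_)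
    (ENNReal.le_of_forall_nnreal_lt fun r hr => ?_)
  -- For `r` beyond `π²/4` but inside the radius, bounded terms would force the exponential `(4 r /
  -- π²) ^ (2 (k + 1))` below a linear function of `k`.
  · by_contra hcon
    push Not at hcon
    have h1 : Real.pi ^ 2 / 4 < r := by
      rw [ENNReal.ofReal, ENNReal.coe_lt_coe, Real.toNNReal_lt_iff_lt_coe (by positivity)] at hcon
      exact hcon
    obtain ⟨C, hC, hCb⟩ := FormalMultilinearSeries.norm_mul_pow_le_of_lt_radius _ hr
    have h2 : 1 < 4 / Real.pi ^ 2 * r := by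
      rw [div_mul_eq_mul_div, one_lt_div (by positivity)]; linarith
    have h3 : ∀ k : ℕ, ((4 / Real.pi ^ 2 * r) ^ 2) ^ (k + 1) ≤ C * (k + 1 : ℕ) := fun k => by
      have h4 := hCb (2 * (k + 1))
      rw [hnorm, logCoeff, if_neg (by omega)] at h4
      have h5 := le_writheLambda_two_mul (Nat.succ_ne_zero k)
      rw [div_mul_eq_mul_div, div_le_iff₀ (by positivity)] at h4
      have h6 : 2 * ((4 / Real.pi ^ 2 * r) ^ 2) ^ (k + 1) ≤
          writheLambda (2 * (k + 1)) * (r : ℝ) ^ (2 * (k + 1)) := by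
        rw [← pow_mul, mul_pow, ← mul_assoc]
        exact mul_le_mul_of_nonneg_right h5 (by positivity)
      push_cast at h4 h6 ⊢
      linarith
    have h7 : 1 < (4 / Real.pi ^ 2 * r) ^ 2 := one_lt_pow₀ h2 two_ne_zero
    have h8 := (tendsto_pow_const_div_const_pow_of_one_lt 1 h7).comp (tendsto_add_atTop_nat 1)
    have h9 : Tendsto (fun k : ℕ => C * (((k + 1 : ℕ) : ℝ) ^ 1 /
        ((4 / Real.pi ^ 2 * r) ^ 2) ^ (k + 1))) atTop (𝓝 (C * 0)) := h8.const_mul C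
    rw [mul_zero] at h9
    obtain ⟨k, hk⟩ := (h9.eventually (gt_mem_nhds zero_lt_one)).exists
    rw [← mul_div_assoc, div_lt_one (by positivity), pow_one] at hk
    exact absurd (h3 k) (not_le.2 hk)
  · refine FormalMultilinearSeries.le_radius_of_summable _ ?_
    simp_rw [hnorm]
    refine summable_logCoeff_mul_pow r.2 ?_
    rw [ENNReal.ofReal, ENNReal.coe_lt_coe, Real.lt_toNNReal_iff_coe_lt] at hr
    exact hr

lemma summable_writheLambda_div_mul_pow {z : ℂ} (hz : ‖z‖ < Real.pi ^ 2 / 4) :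
    Summable (fun m : ℕ =>
      ((writheLambda (m + 1) / ((m + 1 : ℕ) : ℝ) : ℝ) : ℂ) * z ^ (m + 1)) := by
  have h := (summable_nat_add_iff 1).2 (summable_logCoeff_mul_pow (norm_nonneg z) hz)
  refine Summable.of_norm (h.congr fun m => ?_)
  rw [← logCoeff_succ, norm_mul, norm_pow, Complex.norm_real, Real.norm_eq_abs,
    abs_of_nonneg (logCoeff_nonneg _)]

lemma hasFPowerSeriesOnBall_writheLogSeries :
    HasFPowerSeriesOnBall (fun z : ℂ => ∑' m : ℕ,
      ((writheLambda (m + 1) / ((m + 1 : ℕ) : ℝ) : ℝ) : ℂ) * z ^ (m + 1))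
      writheLogSeries 0 (ENNReal.ofReal (Real.pi ^ 2 / 4)) := by
  have hpos : 0 < ENNReal.ofReal (Real.pi ^ 2 / 4) := ENNReal.ofReal_pos.2 (by positivity)
  have h := writheLogSeries.hasFPowerSeriesOnBall (by rw [radius_writheLogSeries]; exact hpos)
  rw [radius_writheLogSeries] at h
  refine h.congr fun z hz => ?_
  have hz' : ‖z‖ < Real.pi ^ 2 / 4 := by
    rw [Metric.mem_eball, edist_zero_right, ← ofReal_norm,
      ENNReal.ofReal_lt_ofReal_iff (by positivity)] at hz
    exact hz
  have hs := (summable_nat_add_iff (f := fun m => (logCoeff m : ℂ) * z ^ m) 1).1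
    (by simpa only [logCoeff_succ] using summable_writheLambda_div_mul_pow hz')
  have h1 : writheLogSeries.sum z = ∑' m, (logCoeff m : ℂ) * z ^ m := by
    rw [writheLogSeries_eq, FormalMultilinearSeries.sum]
    refine tsum_congr fun m => ?_
    simp [mul_comm]
  rw [h1, hs.tsum_eq_zero_add]
  simp [logCoeff]

/-! ### The limit law -/

/-- The double series of `(-c i ^ 2 * t ^ 2) ^ (n + 1) / (n + 1)` summed two ways: over `n` it gives
the logarithms, over `i` the power sums of the scales, which are the `λ`. The bound on `t` makes
every logarithmic series converge. -/
lemma tsum_writheLambda_mul_I (t : ℝ) (ht : |t| < Real.pi ^ 2 / 4) :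
    ∑' m : ℕ, ((writheLambda (m + 1) / ((m + 1 : ℕ) : ℝ) : ℝ) : ℂ) * (t * Complex.I) ^ (m + 1) =
      ((-∑' i, Real.log (1 + laplaceScaleSeq i ^ 2 * t ^ 2) : ℝ) : ℂ) := by
  have hc := fun i : ℕ => laplaceScale_pos i.unpair
  have hlt : ∀ i, laplaceScaleSeq i ^ 2 * t ^ 2 < 1 := fun i => by
    have h1 : laplaceScaleSeq i * |t| < 1 :=
      (mul_le_mul_of_nonneg_right (laplaceScale_le _) (abs_nonneg t)).trans_lt
        (four_div_pi_sq_mul_lt_one ht)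
    have h2 := pow_lt_one₀ (mul_nonneg (hc i).le (abs_nonneg t)) h1 two_ne_zero
    rwa [mul_pow, sq_abs] at h2
  -- the double series whose row sums are `-log (1 + c² t²)`
  set F : ℕ × ℕ → ℝ := fun p => (-(laplaceScaleSeq p.1 ^ 2 * t ^ 2)) ^ (p.2 + 1) / ((p.2 : ℝ) + 1)
    with hF
  have hrow : ∀ i, HasSum (fun n => F (i, n)) (-Real.log (1 + laplaceScaleSeq i ^ 2 * t ^ 2)) :=
    fun i => by
      have h1 : |-(laplaceScaleSeq i ^ 2 * t ^ 2)| < 1 := by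
        rw [abs_neg, abs_of_nonneg (by positivity)]; exact hlt i
      simpa using Real.hasSum_pow_div_log_of_abs_lt_one h1
  have hcol : ∀ n, HasSum (fun i => F (i, n))
      (writheLambda (2 * (n + 1)) / 2 * ((-t ^ 2) ^ (n + 1) / ((n : ℝ) + 1))) := fun n => by
    have h1 := (hasSum_laplaceScaleSeq_pow n.succ_ne_zero).mul_right
      ((-t ^ 2) ^ (n + 1) / ((n : ℝ) + 1))
    have h2 : (fun i => F (i, n)) = fun i => laplaceScaleSeq i ^ (2 * (n + 1)) *
        ((-t ^ 2) ^ (n + 1) / ((n : ℝ) + 1)) := by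
      funext i
      rw [hF, pow_mul, ← mul_div_assoc, ← mul_pow]
      ring_nf
    rw [h2]; exact h1
  have hnorm : ∀ n i, ‖F (i, n)‖ = laplaceScaleSeq i ^ (2 * (n + 1)) *
        ((t ^ 2) ^ (n + 1) / ((n : ℝ) + 1)) := fun n i => by
    rw [hF, Real.norm_eq_abs, abs_div, abs_pow, abs_neg, abs_of_nonneg (by positivity),
      abs_of_nonneg (by positivity), pow_mul, ← mul_div_assoc]
    simp only [mul_pow]
  -- Absolute summability is checked over `i` first, where the sums of norms are exact and dominated
  -- by the `λ` series at `|t|`.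
  have hsum : Summable F := by
    refine Summable.of_norm ((Equiv.prodComm ℕ ℕ).summable_iff.1 ?_)
    have hcn : ∀ n, HasSum (fun i => ‖F (i, n)‖)
        (writheLambda (2 * (n + 1)) / 2 * ((t ^ 2) ^ (n + 1) / ((n : ℝ) + 1))) := fun n => by
      simp_rw [hnorm]
      exact (hasSum_laplaceScaleSeq_pow n.succ_ne_zero).mul_right _
    refine (summable_prod_of_nonneg fun p => norm_nonneg _).2 ⟨fun n => (hcn n).summable, ?_⟩
    have h1 := (summable_writheLambda_mul_pow (abs_nonneg t) ht).comp_injective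
      (i := fun n : ℕ => 2 * n + 1) (fun a b hab => by simpa using hab)
    refine h1.of_nonneg_of_le (fun n => tsum_nonneg fun i => norm_nonneg _) fun n => ?_
    refine (hcn n).tsum_eq.trans_le ?_
    have h2 := writheLambda_nonneg (2 * (n + 1))
    have h3 : (t ^ 2) ^ (n + 1) / ((n : ℝ) + 1) ≤ (t ^ 2) ^ (n + 1) :=
      div_le_self (by positivity) (by linarith [(Nat.cast_nonneg n : (0 : ℝ) ≤ n)])
    have h4 : |t| ^ (2 * (n + 1)) = (t ^ 2) ^ (n + 1) := by rw [pow_mul, sq_abs]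
    have h5 : writheLambda (2 * (n + 1)) / 2 ≤ writheLambda (2 * (n + 1)) := by linarith
    change _ ≤ writheLambda (2 * (n + 1)) * |t| ^ (2 * (n + 1))
    rw [h4]
    exact mul_le_mul h5 h3 (by positivity) h2
  have htot : HasSum (fun n : ℕ =>
      writheLambda (2 * (n + 1)) / 2 * ((-t ^ 2) ^ (n + 1) / ((n : ℝ) + 1)))
      (-∑' i, Real.log (1 + laplaceScaleSeq i ^ 2 * t ^ 2)) := by
    have h1 := hsum.hasSum.prod_fiberwise hrow
    rw [← tsum_neg, h1.tsum_eq]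
    exact ((Equiv.prodComm ℕ ℕ).hasSum_iff.2 hsum.hasSum).prod_fiberwise hcol
  refine HasSum.tsum_eq ?_
  -- Odd-indexed `λ` vanish, so only exponents `m + 1 = 2 (n + 1)`, that is `m = 2 n + 1`, survive.
  refine (Function.Injective.hasSum_iff (g := fun n : ℕ => 2 * n + 1)
    (fun a b hab => by simpa using hab) fun m hm => ?_).1 ?_
  · have h1 : writheLambda (m + 1) = 0 := by
      rw [writheLambda, if_neg]
      rintro ⟨k, hk⟩
      exact hm ⟨k - 1, by simp only; omega⟩
    simp [h1]
  · refine (Complex.hasSum_ofReal.2 htot).congr_fun fun n => ?_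
    have h1 : ((t : ℂ) * Complex.I) ^ (2 * n + 1 + 1) = (((-t ^ 2) ^ (n + 1) : ℝ) : ℂ) := by
      rw [show 2 * n + 1 + 1 = 2 * (n + 1) by ring, pow_mul, mul_pow, Complex.I_sq]
      push_cast; ring
    rw [Function.comp_apply, h1, show 2 * n + 1 + 1 = 2 * (n + 1) by ring]
    push_cast
    field_simp

lemma integrable_cexp_of_integrable_exp_re {μ : Measure ℝ} {z : ℂ}
    (h : Integrable (fun x => Real.exp (z.re * x)) μ) :
    Integrable (fun x : ℝ => Complex.exp (z * x)) μ := by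
  rw [← integrable_norm_iff (by fun_prop)]
  simpa [Complex.norm_exp] using h

lemma mem_interior_integrableExpSet_of_abs_lt {μ : Measure ℝ} {b : ℝ}
    (h : ∀ x : ℝ, |x| < b → Integrable (fun y => Real.exp (x * y)) μ) {x : ℝ} (hx : |x| < b) :
    x ∈ interior (integrableExpSet id μ) := by
  rw [mem_interior]
  exact ⟨{y | |y| < b}, fun y hy => h y hy, isOpen_lt (by fun_prop) (by fun_prop), hx⟩

/-- The moment generating function of a law with the characteristic function of the limit. -/
lemma integral_cexp_eq_of_charFun {μ : Measure ℝ}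
    (hch : ∀ t, charFun μ t =
        ((Real.exp (-∑' i, Real.log (1 + laplaceScaleSeq i ^ 2 * t ^ 2)) : ℝ) : ℂ))
    (hint : ∀ x : ℝ, |x| < Real.pi ^ 2 / 4 → Integrable (fun y => Real.exp (x * y)) μ)
    {z : ℂ} (hz : ‖z‖ < Real.pi ^ 2 / 4) :
    ∫ x : ℝ, Complex.exp (z * x) ∂μ = Complex.exp
      (∑' m : ℕ, ((writheLambda (m + 1) / ((m + 1 : ℕ) : ℝ) : ℝ) : ℂ) * z ^ (m + 1)) := by
  have hR : 0 < Real.pi ^ 2 / 4 := by positivity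
  have hf : AnalyticOnNhd ℂ (complexMGF id μ) (Metric.ball 0 (Real.pi ^ 2 / 4)) := fun w hw => by
    refine analyticAt_complexMGF (mem_interior_integrableExpSet_of_abs_lt hint ?_)
    exact (Complex.abs_re_le_norm w).trans_lt (by simpa using hw)
  have hg : AnalyticOnNhd ℂ (fun z : ℂ => Complex.exp
      (∑' m : ℕ, ((writheLambda (m + 1) / ((m + 1 : ℕ) : ℝ) : ℝ) : ℂ) * z ^ (m + 1)))
      (Metric.ball 0 (Real.pi ^ 2 / 4)) := fun w hw => by
    have h1 := hasFPowerSeriesOnBall_writheLogSeries.analyticOnNhd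
    rw [Metric.eball_ofReal] at h1
    exact (h1 w hw).cexp
  -- Both sides are analytic in the disc and agree on a punctured piece of the imaginary axis, which
  -- accumulates at `0`.
  have heq := hf.eqOn_of_preconnected_of_frequently_eq hg
    (Metric.isPreconnected_ball) (Metric.mem_ball_self hR) ?_
  · exact heq (by simpa using hz)
  · have h1 : Tendsto (fun t : ℝ => (t : ℂ) * Complex.I) (𝓝[≠] 0) (𝓝[≠] 0) := by
      refine tendsto_nhdsWithin_iff.2 ⟨?_, ?_⟩
      · have : Continuous fun t : ℝ => (t : ℂ) * Complex.I := by fun_prop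
        simpa using (this.tendsto 0).mono_left nhdsWithin_le_nhds
      · filter_upwards [self_mem_nhdsWithin] with t ht
        simpa using ht
    refine h1.frequently (Eventually.frequently ?_)
    have h2 : ∀ᶠ t : ℝ in 𝓝[≠] 0, |t| < Real.pi ^ 2 / 4 := by
      refine Filter.Eventually.filter_mono nhdsWithin_le_nhds ?_
      exact (isOpen_lt (by fun_prop) (by fun_prop) :
        IsOpen {t : ℝ | |t| < Real.pi ^ 2 / 4}).mem_nhds (by simpa using hR)
    filter_upwards [h2] with t ht
    rw [complexMGF_id_mul_I, hch, tsum_writheLambda_mul_I t ht, Complex.ofReal_exp]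

/-- Two laws whose moment generating functions exist and agree near `0` are equal. -/
lemma ext_of_eventually_mgf_eq {μ ν : Measure ℝ} [IsProbabilityMeasure μ] [IsProbabilityMeasure ν]
    (hμ : ∀ᶠ t : ℝ in 𝓝 0, Integrable (fun x => Real.exp (t * x)) μ)
    (hν : ∀ᶠ t : ℝ in 𝓝 0, Integrable (fun x => Real.exp (t * x)) ν)
    (h : ∀ᶠ t : ℝ in 𝓝 0, ∫ x, Real.exp (t * x) ∂μ = ∫ x, Real.exp (t * x) ∂ν) : μ = ν := by
  obtain ⟨b, hb, hball⟩ := Metric.eventually_nhds_iff.1 (hμ.and hν)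
  have hμ' : ∀ x : ℝ, |x| < b → Integrable (fun y => Real.exp (x * y)) μ := fun x hx =>
    (hball (by simpa using hx)).1
  have hν' : ∀ x : ℝ, |x| < b → Integrable (fun y => Real.exp (x * y)) ν := fun x hx =>
    (hball (by simpa using hx)).2
  have hconv : Convex ℝ {z : ℂ | |z.re| < b} := by
    have : {z : ℂ | |z.re| < b} = Complex.reLm ⁻¹' Set.Ioo (-b) b := by
      ext z; simp [abs_lt]
    rw [this]
    exact (convex_Ioo _ _).linear_preimage _
  -- Agreement on the real axis near `0` propagates through the strip `|re z| < b`, which contains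
  -- the whole imaginary axis and hence determines the characteristic functions.
  have heq : Set.EqOn (complexMGF id μ) (complexMGF id ν) {z : ℂ | |z.re| < b} := by
    refine AnalyticOnNhd.eqOn_of_preconnected_of_frequently_eq
      (fun z hz => analyticAt_complexMGF (mem_interior_integrableExpSet_of_abs_lt hμ' hz))
      (fun z hz => analyticAt_complexMGF (mem_interior_integrableExpSet_of_abs_lt hν' hz))
      hconv.isPreconnected (z₀ := 0) (by simpa using hb) ?_
    have h1 : Tendsto (fun t : ℝ => (t : ℂ)) (𝓝[≠] 0) (𝓝[≠] 0) := by
      refine tendsto_nhdsWithin_iff.2 ⟨?_, ?_⟩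
      · simpa using (Complex.continuous_ofReal.tendsto 0).mono_left nhdsWithin_le_nhds
      · filter_upwards [self_mem_nhdsWithin] with t ht
        simpa using ht
    refine h1.frequently (Eventually.frequently ?_)
    filter_upwards [h.filter_mono nhdsWithin_le_nhds] with t ht
    rw [complexMGF_ofReal, complexMGF_ofReal]
    exact_mod_cast ht
  refine Measure.ext_of_charFun (funext fun t => ?_)
  rw [← complexMGF_id_mul_I, ← complexMGF_id_mul_I]
  exact heq (by simpa using hb)

/-- The limit law, characterized by its characteristic function, with the properties that do not
involve the writhe. -/
theorem exists_writhe_limit_law :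
    ∃ W : ProbabilityMeasure ℝ,
      (∀ t, charFun (W : Measure ℝ) t =
        ((Real.exp (-∑' i, Real.log (1 + laplaceScaleSeq i ^ 2 * t ^ 2)) : ℝ) : ℂ)) ∧
      (W : Measure ℝ) ≪ volume ∧
      (∀ x : ℝ, |x| < Real.pi ^ 2 / 4 →
        Integrable (fun y => Real.exp (x * y)) (W : Measure ℝ)) ∧
      Tendsto (fun t : ℝ => (1 / t) * Real.log ((W : Measure ℝ).real {x : ℝ | t < |x|}))
        atTop (𝓝 (-(Real.pi ^ 2 / 4))) := by
  have hs := summable_laplaceScaleSeq_sq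
  have hb : 0 < Real.pi ^ 2 / 4 := by positivity
  have hb' : (Real.pi ^ 2 / 4)⁻¹ = laplaceScaleSeq 0 := by rw [laplaceScaleSeq_zero, inv_div]
  -- The largest scale is split off as a separate Laplace factor; absolute continuity and the lower
  -- tail bound survive convolution with the rest.
  obtain ⟨ν, hν1, hν2⟩ := exists_laplace_series (fun i => laplaceScaleSeq (i + 1))
    (fun i => laplaceScale_pos _) ((summable_nat_add_iff 1).2 hs)
  have := isProbabilityMeasure_laplaceMeasure hb
  have hint : ∀ x : ℝ, |x| < Real.pi ^ 2 / 4 → Integrable (fun y => Real.exp (x * y))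
      ((ν : Measure ℝ) ∗ laplaceMeasure (Real.pi ^ 2 / 4)) := fun x hx => by
    refine ⟨by fun_prop, ?_⟩
    rw [hasFiniteIntegral_iff_ofReal (ae_of_all _ fun x => (Real.exp_pos _).le),
      lintegral_exp_conv, lintegral_exp_laplaceMeasure hx]
    refine ENNReal.mul_lt_top ?_ ENNReal.ofReal_lt_top
    have h1 := (hν2 x fun i => (mul_le_mul_of_nonneg_right (laplaceScale_le _)
      (abs_nonneg x)).trans_lt (four_div_pi_sq_mul_lt_one hx)).2
    rwa [hasFiniteIntegral_iff_ofReal (ae_of_all _ fun x => (Real.exp_pos _).le)] at h1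
  obtain ⟨C, hC, hC'⟩ := exists_tail_laplace_conv _ hb (ν : Measure ℝ)
  have htail := tendsto_log_tail_of_bounds hb hC hint hC'
  refine ⟨⟨(ν : Measure ℝ) ∗ laplaceMeasure (Real.pi ^ 2 / 4), inferInstance⟩, fun t => ?_,
    Measure.conv_absolutelyContinuous (laplaceMeasure_absolutelyContinuous _), hint, htail⟩
  rw [ProbabilityMeasure.coe_mk, charFun_conv, hν1, charFun_laplaceMeasure hb, hb',
    (summable_log_one_add_sq_mul hs t).tsum_eq_zero_add, neg_add, Real.exp_add, mul_comm,
    ← Complex.ofReal_mul, ← Real.log_inv, Real.exp_log (by positivity)]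

/-! ### Independent uniform points on the circle -/

instance isProbabilityMeasure_volume_unitAddCircle :
    IsProbabilityMeasure (volume : Measure UnitAddCircle) :=
  ⟨UnitAddCircle.measure_univ⟩

instance isProbabilityMeasure_volume_pi_unitAddCircle {ι : Type*} [Fintype ι] :
    IsProbabilityMeasure (volume : Measure (ι → UnitAddCircle)) := by
  rw [volume_pi]; infer_instance

section Shift

variable {ι : Type*} [Fintype ι] [DecidableEq ι]

/-- Averaging over the shifts of one coordinate does not change the mean. -/
lemma integral_eq_integral_integral_add_single (j : ι) {F : (ι → UnitAddCircle) → ℝ} {C : ℝ}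
    (hF : Measurable F) (hC : ∀ U, |F U| ≤ C) :
    ∫ U, F U = ∫ U : ι → UnitAddCircle, ∫ a : UnitAddCircle, F (U + Pi.single j a) := by
  have hm : Measurable fun p : (ι → UnitAddCircle) × UnitAddCircle =>
      p.1 + Pi.single j p.2 := by
    refine measurable_pi_lambda _ fun i => ?_
    by_cases h : i = j
    · subst h
      simp only [Pi.add_apply, Pi.single_eq_same]
      fun_prop
    · simp only [Pi.add_apply, Pi.single_eq_of_ne h, add_zero]
      fun_prop
  have hint : Integrable (Function.uncurry fun (U : ι → UnitAddCircle) (a : UnitAddCircle) =>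
      F (U + Pi.single j a)) ((volume : Measure (ι → UnitAddCircle)).prod volume) :=
    Integrable.of_bound (hF.comp hm).aestronglyMeasurable C (ae_of_all _ fun p => hC _)
  rw [integral_integral_swap hint]
  simp_rw [integral_add_right_eq_self]
  simp

lemma integral_comp_sub_eq {i j : ι} (hij : i ≠ j) {f : UnitAddCircle → ℝ} {C : ℝ}
    (hf : Measurable f) (hC : ∀ x, |f x| ≤ C) :
    ∫ U : ι → UnitAddCircle, f (U j - U i) = ∫ x, f x := by
  rw [integral_eq_integral_integral_add_single j (C := C) (by fun_prop) fun U => hC _]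
  have h1 : ∀ U : ι → UnitAddCircle, ∫ a, f ((U + Pi.single j a : ι → UnitAddCircle) j -
        (U + Pi.single j a : ι → UnitAddCircle) i) =
      ∫ x, f x := fun U => by
    simp only [Pi.add_apply, Pi.single_eq_same, Pi.single_eq_of_ne hij, add_zero]
    rw [← integral_add_left_eq_self f (U j - U i)]
    congr 1; funext a; congr 1; abel
  simp_rw [h1]
  simp

/-- The coordinate `j` occurs only in the first factor, so averaging over its shifts replaces `f` by
its mean, which is `0`. -/
lemma integral_mul_comp_sub_eq_zero_of_notMem_right {i j k l : ι} (hji : j ≠ i) (hjk : j ≠ k)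
    (hjl : j ≠ l) {f g : UnitAddCircle → ℝ} {C D : ℝ}
    (hf : Measurable f) (hg : Measurable g) (hC : ∀ x, |f x| ≤ C) (hD : ∀ x, |g x| ≤ D)
    (h0 : ∫ x, f x = 0) :
    ∫ U : ι → UnitAddCircle, f (U j - U i) * g (U l - U k) = 0 := by
  rw [integral_eq_integral_integral_add_single j (C := C * D) (by fun_prop) fun U => by
    rw [abs_mul]
    exact mul_le_mul (hC _) (hD _) (abs_nonneg _) ((abs_nonneg _).trans (hC 0))]
  have h1 : ∀ U : ι → UnitAddCircle, ∫ a, f ((U + Pi.single j a : ι → UnitAddCircle) j -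
        (U + Pi.single j a : ι → UnitAddCircle) i) *
        g ((U + Pi.single j a : ι → UnitAddCircle) l -
          (U + Pi.single j a : ι → UnitAddCircle) k) = 0 := fun U => by
    simp only [Pi.add_apply, Pi.single_eq_same, Pi.single_eq_of_ne hji.symm,
      Pi.single_eq_of_ne hjk.symm, Pi.single_eq_of_ne hjl.symm, add_zero]
    rw [integral_mul_const]
    have h2 : ∫ a, f (U j + a - U i) = 0 := by
      rw [← h0, ← integral_add_left_eq_self f (U j - U i)]
      congr 1; funext a; congr 1; abel
    rw [h2, zero_mul]
  simp_rw [h1]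
  simp

lemma integral_mul_comp_sub_eq_zero_of_notMem_left {i j k l : ι} (hji : j ≠ i) (hik : i ≠ k)
    (hil : i ≠ l) {f g : UnitAddCircle → ℝ} {C D : ℝ}
    (hf : Measurable f) (hg : Measurable g) (hC : ∀ x, |f x| ≤ C) (hD : ∀ x, |g x| ≤ D)
    (h0 : ∫ x, f x = 0) :
    ∫ U : ι → UnitAddCircle, f (U j - U i) * g (U l - U k) = 0 := by
  have h1 := integral_mul_comp_sub_eq_zero_of_notMem_right (f := fun x => f (-x)) hji.symm hik hil
    (by fun_prop) hg (fun x => hC _) hD (by rw [integral_neg_eq_self, h0])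
  simpa using h1

/-- A difference `U j - U i` is uniform on the circle, so it avoids `0` almost surely. -/
lemma ae_injective : ∀ᵐ U : ι → UnitAddCircle, Function.Injective U := by
  have h : ∀ i j : ι, i ≠ j → ∀ᵐ U : ι → UnitAddCircle, U i ≠ U j := fun i j hij => by
    have h1 := integral_comp_sub_eq hij (f := Set.indicator {0} 1) (C := 1)
      (measurable_one.indicator (measurableSet_singleton _)) fun x => by
        by_cases hx : x = 0 <;> simp [hx]
    have h2 : (volume : Measure UnitAddCircle) {0} = 0 := by
      rw [← Metric.closedBall_zero, AddCircle.volume_closedBall]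
      simp
    rw [integral_indicator_one (measurableSet_singleton _), measureReal_def, h2,
      ENNReal.toReal_zero] at h1
    have hms : MeasurableSet {U : ι → UnitAddCircle | U j - U i = 0} :=
      measurableSet_eq_fun (by fun_prop) measurable_const
    have h3 : (fun U : ι → UnitAddCircle => Set.indicator {0} (1 : UnitAddCircle → ℝ) (U j - U i)) =
        Set.indicator {U | U j - U i = 0} 1 := by
      funext U; simp [Set.indicator]
    rw [h3, integral_indicator_one hms, measureReal_eq_zero_iff] at h1
    filter_upwards [measure_eq_zero_iff_ae_notMem.1 h1] with U hU hU'
    exact hU (by simp [hU'])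
  have h' : ∀ᵐ U : ι → UnitAddCircle, ∀ i j : ι, i ≠ j → U i ≠ U j := by
    simpa only [ae_all_iff] using h
  filter_upwards [h'] with U hU i j hij
  by_contra hne
  exact hU i j hne hij

end Shift

lemma integral_comp_perm {ι : Type*} [Fintype ι] (τ : Equiv.Perm ι) (F : (ι → UnitAddCircle) → ℂ) :
    ∫ U : ι → UnitAddCircle, F (U ∘ τ) = ∫ U, F U := by
  have h := (volume_measurePreserving_piCongrLeft (fun _ : ι => UnitAddCircle) τ.symm)
  have h1 := h.integral_comp (MeasurableEquiv.measurableEmbedding _) F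
  rw [← h1]
  congr 1; funext U; congr 1; funext i
  rw [MeasurableEquiv.coe_piCongrLeft, Equiv.piCongrLeft_apply]
  simp

/-! ### The writhe of independent uniform heights -/

/-- The representative in `[0, 1)` of a point of the circle. -/
noncomputable def circleLift (x : UnitAddCircle) : ℝ := (AddCircle.equivIco 1 0 x : ℝ)

lemma measurable_circleLift : Measurable circleLift :=
  measurable_subtype_coe.comp (AddCircle.measurableEquivIco 1 0).measurable

lemma circleLift_nonneg (x : UnitAddCircle) : 0 ≤ circleLift x := (AddCircle.equivIco 1 0 x).2.1

lemma circleLift_lt_one (x : UnitAddCircle) : circleLift x < 1 := by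
  have h : circleLift x < 0 + 1 := (AddCircle.equivIco (1 : ℝ) 0 x).2.2
  rwa [zero_add] at h

lemma coe_circleLift (x : UnitAddCircle) : (circleLift x : UnitAddCircle) = x :=
  AddCircle.coe_equivIco

lemma circleLift_coe {y : ℝ} (h0 : 0 ≤ y) (h1 : y < 1) : circleLift (y : UnitAddCircle) = y := by
  rw [circleLift, AddCircle.equivIco_coe_eq (p := (1 : ℝ)) (a := 0) ⟨h0, by simpa using h1⟩]

lemma injective_circleLift : Function.Injective circleLift := fun x y h => by
  rw [← coe_circleLift x, h, coe_circleLift]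

/-- The permutation sends `x` to its rank, the number of points with a smaller value. -/
lemma exists_perm_lt_iff (n : ℕ) (f : ZMod (2 * n + 1) → ℝ) (hf : Function.Injective f) :
    ∃ σ : Equiv.Perm (ZMod (2 * n + 1)), ∀ x y, f x < f y ↔ (σ x).val < (σ y).val := by
  classical
  set rk : ZMod (2 * n + 1) → ℕ := fun x => (Finset.univ.filter fun y => f y < f x).card with hrk
  have hlt : ∀ x, rk x < 2 * n + 1 := fun x => by
    have h1 : rk x < (Finset.univ : Finset (ZMod (2 * n + 1))).card :=
      Finset.card_lt_card (Finset.filter_ssubset.2 ⟨x, Finset.mem_univ _, lt_irrefl _⟩)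
    simpa [ZMod.card] using h1
  have hmono : ∀ x y, f x < f y → rk x < rk y := fun x y hxy => by
    refine Finset.card_lt_card (Finset.ssubset_iff_of_subset ?_ |>.2 ⟨x, ?_, ?_⟩)
    · intro z hz
      simp only [Finset.mem_filter, Finset.mem_univ, true_and] at hz ⊢
      exact hz.trans hxy
    · simpa using hxy
    · simp
  have hiff : ∀ x y, f x < f y ↔ rk x < rk y := fun x y => by
    refine ⟨hmono x y, fun h => ?_⟩
    by_contra hn
    rcases (not_lt.1 hn).eq_or_lt with h' | h'
    · rw [hf h'] at h; exact lt_irrefl _ h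
    · exact lt_asymm h (hmono _ _ h')
  have hval : ∀ x, ((rk x : ℕ) : ZMod (2 * n + 1)).val = rk x := fun x =>
    ZMod.val_cast_of_lt (hlt x)
  have hinj : Function.Injective fun x => ((rk x : ℕ) : ZMod (2 * n + 1)) := fun x y h => by
    have h1 : rk x = rk y := by rw [← hval x, ← hval y]; exact congrArg ZMod.val h
    by_contra hne
    rcases lt_or_gt_of_ne (hf.ne hne) with h' | h'
    · exact absurd (hmono _ _ h') (by omega)
    · exact absurd (hmono _ _ h') (by omega)
  refine ⟨Equiv.ofBijective _ (Finite.injective_iff_bijective.1 hinj), fun x y => ?_⟩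
  simp only [Equiv.ofBijective_apply, hval]
  exact hiff x y

lemma writhe_congr {n : ℕ} {f g : ZMod (2 * n + 1) → ℝ} (h : ∀ x y, f x < f y ↔ g x < g y) :
    writhe n f = writhe n g := by
  unfold writhe
  refine Finset.sum_congr rfl fun i _ => Finset.sum_congr rfl fun j _ => ?_
  congr 1
  simp only [sign_apply, sub_pos, sub_neg, h]

lemma measurable_writhe (n : ℕ) :
    Measurable fun f : ZMod (2 * n + 1) → ℝ => ((writhe n f : ℤ) : ℝ) := by
  have hs : Measurable fun x : ℝ => (SignType.sign x : ℝ) := by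
    have : (fun x : ℝ => (SignType.sign x : ℝ)) =
        fun x => if 0 < x then 1 else if x < 0 then -1 else 0 := by
      funext x
      simp only [sign_apply]
      split_ifs <;> simp
    rw [this]
    exact Measurable.ite measurableSet_Ioi measurable_const
      (Measurable.ite measurableSet_Iio measurable_const measurable_const)
  unfold writhe
  push_cast
  exact Finset.measurable_sum _ fun i _ => Finset.measurable_sum _ fun j _ =>
    hs.comp ((measurable_pi_apply _).sub (measurable_pi_apply _))

/-- The law of `U` is invariant under relabeling coordinates. Averaging over all relabelings of one
injective `U` meets every ranking exactly once, so the average does not depend on `U`. -/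
lemma integral_writhe_circleLift (n : ℕ) {g : ℝ → ℂ} (hg : Continuous g) {C : ℝ}
    (hC : ∀ x, ‖g x‖ ≤ C) :
    ∫ U : ZMod (2 * n + 1) → UnitAddCircle, g (writhe n (circleLift ∘ U)) =
      (Fintype.card (Equiv.Perm (ZMod (2 * n + 1))) : ℂ)⁻¹ *
        ∑ σ : Equiv.Perm (ZMod (2 * n + 1)), g (permWrithe n σ) := by
  have hcard : (Fintype.card (Equiv.Perm (ZMod (2 * n + 1))) : ℂ) ≠ 0 := by
    exact_mod_cast Fintype.card_ne_zero
  rw [eq_inv_mul_iff_mul_eq₀ hcard]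
  set F : (ZMod (2 * n + 1) → UnitAddCircle) → ℂ := fun U => g (writhe n (circleLift ∘ U)) with hF
  have hFm : Measurable F := hg.measurable.comp ((measurable_writhe n).comp
    (measurable_pi_lambda _ fun i => measurable_circleLift.comp (measurable_pi_apply i)))
  have hFi : ∀ τ : Equiv.Perm (ZMod (2 * n + 1)), Integrable fun U => F (U ∘ τ) := fun τ =>
    have hm : Measurable fun U : ZMod (2 * n + 1) → UnitAddCircle => U ∘ τ :=
      measurable_pi_lambda _ fun i => measurable_pi_apply (τ i)
    Integrable.of_bound (hFm.comp hm).aestronglyMeasurable C (ae_of_all _ fun U => hC _)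
  have h1 : (Fintype.card (Equiv.Perm (ZMod (2 * n + 1))) : ℂ) * ∫ U, F U =
      ∫ U, ∑ τ : Equiv.Perm (ZMod (2 * n + 1)), F (U ∘ τ) := by
    rw [integral_finsetSum _ fun τ _ => hFi τ]
    simp_rw [integral_comp_perm]
    simp
  rw [h1]
  have h2 : ∀ᵐ U : ZMod (2 * n + 1) → UnitAddCircle,
      ∑ τ : Equiv.Perm (ZMod (2 * n + 1)), F (U ∘ τ) =
        ∑ σ : Equiv.Perm (ZMod (2 * n + 1)), g (permWrithe n σ) := by
    filter_upwards [ae_injective] with U hU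
    obtain ⟨σ, hσ⟩ := exists_perm_lt_iff n (circleLift ∘ U) (injective_circleLift.comp hU)
    -- If `σ` ranks `U`, then `σ * τ` ranks `U ∘ τ`.
    rw [← Equiv.sum_comp (Equiv.mulLeft σ) fun σ => g (permWrithe n σ)]
    refine Finset.sum_congr rfl fun τ _ => ?_
    simp only [hF, permWrithe, Equiv.coe_mulLeft, Equiv.Perm.coe_mul, Function.comp_apply]
    refine congrArg (fun k : ℤ => g k) (writhe_congr fun x y => ?_)
    rw [Nat.cast_lt, ← hσ]
    rfl
  rw [integral_congr_ae h2]
  simp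

lemma charFun_normalizedWritheLaw (n : ℕ) (t : ℝ) :
    charFun (normalizedWritheLaw n : Measure ℝ) t =
      ∫ U : ZMod (2 * n + 1) → UnitAddCircle,
        Complex.exp (((t * (writhe n (circleLift ∘ U) / n) : ℝ) : ℂ) * Complex.I) := by
  rw [integral_writhe_circleLift n (g := fun x => Complex.exp (((t * (x / n) : ℝ) : ℂ) * Complex.I))
    (by fun_prop) (C := 1) fun x => by rw [Complex.norm_exp_ofReal_mul_I]]
  rw [charFun_apply_real, normalizedWritheLaw, ProbabilityMeasure.coe_mk]
  -- With the discrete σ-algebra the law is a genuine pushforward, and its integrals become finite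
  -- averages.
  let : MeasurableSpace (Equiv.Perm (ZMod (2 * n + 1))) := ⊤
  have : MeasurableSingletonClass (Equiv.Perm (ZMod (2 * n + 1))) := ⟨fun _ => trivial⟩
  have hm : Measurable fun σ : Equiv.Perm (ZMod (2 * n + 1)) => (permWrithe n σ : ℝ) / (n : ℝ) :=
    fun _ _ => trivial
  rw [← PMF.toMeasure_map _ _ hm, integral_map hm.aemeasurable (by fun_prop), PMF.integral_eq_sum,
    Finset.mul_sum]
  refine Finset.sum_congr rfl fun σ _ => ?_
  simp [PMF.uniformOfFintype_apply]

/-! ### The periodic kernel -/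

/-- The odd `1`-periodic sawtooth, equal to `1 - 2 x` on `(0, 1)`. -/
noncomputable def sawtooth (x : UnitAddCircle) : ℝ := if x = 0 then 0 else 1 - 2 * circleLift x

lemma measurable_sawtooth : Measurable sawtooth :=
  Measurable.ite (measurableSet_singleton 0) measurable_const
    (measurable_const.sub (measurable_const.mul measurable_circleLift))

lemma abs_sawtooth_le (x : UnitAddCircle) : |sawtooth x| ≤ 1 := by
  unfold sawtooth
  split_ifs
  · simp
  · rw [abs_le]
    constructor <;> linarith [circleLift_nonneg x, circleLift_lt_one x]

lemma sawtooth_coe {x : ℝ} (hx : x ∈ Set.Ioo (0 : ℝ) 1) :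
    sawtooth (x : UnitAddCircle) = 1 - 2 * x := by
  have h1 := circleLift_coe hx.1.le hx.2
  rw [sawtooth, if_neg, h1]
  intro h
  have h2 : circleLift ((0 : ℝ) : UnitAddCircle) = 0 := circleLift_coe le_rfl one_pos
  rw [h, ← AddCircle.coe_zero (p := (1 : ℝ)), h2] at h1
  exact hx.1.ne h1

/-- This makes the sign translation invariant up to a linear term: the sawtooth depends only on `v -
u` in the circle. -/
lemma sign_circleLift_sub (u v : UnitAddCircle) :
    (SignType.sign (circleLift v - circleLift u) : ℝ) =
      sawtooth (v - u) + 2 * (circleLift v - circleLift u) := by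
  have hv := coe_circleLift v
  have hu := coe_circleLift u
  have hu0 := circleLift_nonneg u
  have hv0 := circleLift_nonneg v
  have hu1 := circleLift_lt_one u
  have hv1 := circleLift_lt_one v
  rcases lt_trichotomy (circleLift u) (circleLift v) with h | h | h
  · have h1 : v - u = ((circleLift v - circleLift u : ℝ) : UnitAddCircle) := by
      rw [AddCircle.coe_sub, hu, hv]
    rw [sign_pos (sub_pos.2 h), h1, sawtooth_coe ⟨sub_pos.2 h, by linarith⟩]
    simp
  · rw [injective_circleLift h]
    simp [sawtooth]
  · have h1 : v - u = ((circleLift v - circleLift u + 1 : ℝ) : UnitAddCircle) := by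
      rw [AddCircle.coe_add, AddCircle.coe_period, AddCircle.coe_sub, hu, hv, add_zero]
    rw [sign_neg (sub_neg.2 h), h1, sawtooth_coe ⟨by linarith, by linarith⟩]
    simp; ring

/-- For each fixed `d` the linear terms sum to zero over `i`, because `i ↦ i + d` is a bijection of
`ℤ/(2n+1)`. -/
lemma writhe_circleLift_eq (n : ℕ) (U : ZMod (2 * n + 1) → UnitAddCircle) :
    (writhe n (circleLift ∘ U) : ℝ) =
      ∑ i : ZMod (2 * n + 1), ∑ d ∈ Finset.Icc 1 n,
        sawtooth (U (i + (d : ZMod (2 * n + 1))) - U i) := by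
  have h1 : ∀ d : ℕ, ∑ i : ZMod (2 * n + 1),
      2 * (circleLift (U (i + (d : ZMod (2 * n + 1)))) - circleLift (U i)) = 0 := fun d => by
    have h2 : ∑ i, circleLift (U (i + (d : ZMod (2 * n + 1)))) = ∑ i, circleLift (U i) :=
      Equiv.sum_comp (Equiv.addRight (d : ZMod (2 * n + 1))) fun i => circleLift (U i)
    rw [← Finset.mul_sum, Finset.sum_sub_distrib, h2, sub_self, mul_zero]
  unfold writhe
  push_cast
  simp only [Function.comp_apply, sign_circleLift_sub, Finset.sum_add_distrib]
  rw [add_eq_left, Finset.sum_comm]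
  exact Finset.sum_eq_zero fun d _ => h1 d

lemma integral_unitAddCircle_eq {f : UnitAddCircle → ℝ} {g : ℝ → ℝ}
    (h : ∀ x ∈ Set.Ioo (0 : ℝ) 1, f x = g x) : ∫ x, f x = ∫ x in (0 : ℝ)..1, g x := by
  rw [← UnitAddCircle.integral_preimage 0, intervalIntegral.integral_of_le zero_le_one,
    zero_add, integral_Ioc_eq_integral_Ioo, integral_Ioc_eq_integral_Ioo]
  exact setIntegral_congr_fun measurableSet_Ioo h

/-- The function `sin (2 π l x)` on the circle. -/
noncomputable def circleSin (l : ℕ) (x : UnitAddCircle) : ℝ := (fourier (T := 1) (l : ℤ) x).im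

lemma circleSin_coe (l : ℕ) (x : ℝ) :
    circleSin l (x : UnitAddCircle) = Real.sin (2 * Real.pi * l * x) := by
  rw [circleSin, fourier_coe_apply]
  have : (2 * Real.pi * Complex.I * ((l : ℤ) : ℂ) * x / ((1 : ℝ) : ℂ) : ℂ) =
      ((2 * Real.pi * l * x : ℝ) : ℂ) * Complex.I := by push_cast; ring
  rw [this, Complex.exp_ofReal_mul_I_im]

lemma measurable_circleSin (l : ℕ) : Measurable (circleSin l) :=
  (Complex.continuous_im.comp (fourier (T := 1) (l : ℤ)).continuous).measurable

lemma abs_circleSin_le (l : ℕ) (x : UnitAddCircle) : |circleSin l x| ≤ 1 := by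
  rw [circleSin]
  refine (Complex.abs_im_le_norm _).trans (le_of_eq ?_)
  exact Circle.norm_coe _

lemma integrable_of_measurable_of_abs_le {α : Type*} [MeasurableSpace α] {μ : Measure α}
    [IsFiniteMeasure μ] {f : α → ℝ} {C : ℝ} (hf : Measurable f) (hC : ∀ x, |f x| ≤ C) :
    Integrable f μ :=
  Integrable.of_bound hf.aestronglyMeasurable C (ae_of_all _ hC)

lemma integral_fourier (l : ℤ) :
    ∫ x : UnitAddCircle, fourier (T := 1) l x = if l = 0 then 1 else 0 := by
  have h := congrFun (fourierCoeff_fourier (T := 1) l) 0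
  rw [fourierCoeff, AddCircle.integral_haarAddCircle] at h
  simp only [neg_zero, fourier_zero, one_smul, inv_one] at h
  rw [h, Pi.single_apply]
  simp only [eq_comm]

lemma integrable_fourier (l : ℤ) : Integrable fun x : UnitAddCircle => fourier (T := 1) l x :=
  Integrable.of_bound (fourier (T := 1) l).continuous.aestronglyMeasurable 1
    (ae_of_all _ fun _ => (Circle.norm_coe _).le)

lemma integral_circleSin {l : ℕ} : ∫ x, circleSin l x = 0 := by
  have h : ∫ x, circleSin l x = (∫ x : UnitAddCircle, fourier (T := 1) (l : ℤ) x).im :=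
    Complex.imCLM.integral_comp_comm (integrable_fourier _)
  rw [h, integral_fourier]
  split_ifs <;> simp

lemma integral_circleSin_mul {l m : ℕ} (hl : l ≠ 0) :
    ∫ x, circleSin l x * circleSin m x = if l = m then 1 / 2 else 0 := by
  have h1 : ∀ x : UnitAddCircle, circleSin l x * circleSin m x =
      (1 / 2) * ((fourier (T := 1) ((l : ℤ) - m) x).re - (fourier (T := 1) ((l : ℤ) + m) x).re) :=
    fun x => by
      rw [sub_eq_add_neg (l : ℤ), fourier_add, fourier_add, fourier_neg, circleSin, circleSin]
      simp only [Complex.mul_re, Complex.conj_re, Complex.conj_im]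
      ring
  have h2 : ∀ k : ℤ, ∫ x : UnitAddCircle, (fourier (T := 1) k x).re = if k = 0 then 1 else 0 :=
    fun k => by
      have h : ∫ x : UnitAddCircle, (fourier (T := 1) k x).re =
          (∫ x : UnitAddCircle, fourier (T := 1) k x).re :=
        Complex.reCLM.integral_comp_comm (integrable_fourier _)
      rw [h, integral_fourier]
      split_ifs <;> simp
  simp_rw [h1]
  have h3 : ∀ k : ℤ, Integrable fun x : UnitAddCircle => (fourier (T := 1) k x).re :=
    fun k => (integrable_fourier k).re
  rw [integral_const_mul, integral_sub (h3 _) (h3 _), h2, h2, if_neg (by omega : ¬ ((l : ℤ) + m = 0))]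
  by_cases h : l = m
  · simp [h]
  · rw [if_neg (by omega), if_neg h]; simp

/-! ### Fourier coefficients and truncation of the sawtooth. -/

lemma integral_sawtooth : ∫ x, sawtooth x = 0 := by
  rw [integral_unitAddCircle_eq (g := fun x => 1 - 2 * x) fun x hx => sawtooth_coe hx]
  rw [intervalIntegral.integral_sub (Continuous.intervalIntegrable (by fun_prop) _ _)
    (Continuous.intervalIntegrable (by fun_prop) _ _), intervalIntegral.integral_const_mul]
  simp

lemma integral_sawtooth_sq : ∫ x, sawtooth x ^ 2 = 1 / 3 := by
  rw [integral_unitAddCircle_eq (g := fun x => (1 - 2 * x) ^ 2) fun x hx => by rw [sawtooth_coe hx]]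
  have h : ∀ x ∈ Set.uIcc (0 : ℝ) 1, HasDerivAt (fun x : ℝ => -(1 - 2 * x) ^ 3 / 6)
      ((1 - 2 * x) ^ 2) x := fun x _ => by
    have h1 : HasDerivAt (fun x : ℝ => 1 - 2 * x) (-(2 * 1)) x :=
      ((hasDerivAt_id x).const_mul 2).const_sub 1
    have h2 := ((h1.pow 3).neg).div_const 6
    refine h2.congr_deriv ?_
    simp; ring
  rw [intervalIntegral.integral_eq_sub_of_hasDerivAt h
    (Continuous.intervalIntegrable (by fun_prop) _ _)]
  norm_num

lemma integral_sawtooth_mul_circleSin {l : ℕ} (hl : l ≠ 0) :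
    ∫ x, sawtooth x * circleSin l x = 1 / (Real.pi * l) := by
  have hl' : (l : ℝ) ≠ 0 := by exact_mod_cast hl
  have hpi := Real.pi_ne_zero
  rw [integral_unitAddCircle_eq (g := fun x => (1 - 2 * x) * Real.sin (2 * Real.pi * l * x))
    fun x hx => by rw [sawtooth_coe hx, circleSin_coe]]
  set ω := 2 * Real.pi * l with hω
  have hω0 : ω ≠ 0 := by positivity
  have h : ∀ x ∈ Set.uIcc (0 : ℝ) 1, HasDerivAt
      (fun x : ℝ => -((1 - 2 * x) * Real.cos (ω * x) / ω) - 2 * Real.sin (ω * x) / ω ^ 2)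
      ((1 - 2 * x) * Real.sin (ω * x)) x := fun x _ => by
    have h1 : HasDerivAt (fun x : ℝ => 1 - 2 * x) (-(2 * 1)) x :=
      ((hasDerivAt_id x).const_mul 2).const_sub 1
    have h0 : HasDerivAt (fun x : ℝ => ω * x) (ω * 1) x := (hasDerivAt_id x).const_mul ω
    have h2 := ((h1.mul h0.cos).div_const ω).neg.sub ((h0.sin.const_mul 2).div_const (ω ^ 2))
    refine h2.congr_deriv ?_
    field_simp
    ring
  rw [intervalIntegral.integral_eq_sub_of_hasDerivAt h
    (Continuous.intervalIntegrable (by fun_prop) _ _)]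
  have hs : Real.sin ω = 0 := by
    rw [hω, show 2 * Real.pi * l = ((2 * l : ℕ) : ℝ) * Real.pi by push_cast; ring]
    exact Real.sin_nat_mul_pi _
  have hc : Real.cos ω = 1 := by
    rw [hω, show 2 * Real.pi * l = (l : ℝ) * (2 * Real.pi) by ring]
    exact Real.cos_nat_mul_two_pi _
  simp only [mul_one, mul_zero, hs, hc, Real.cos_zero, Real.sin_zero]
  rw [hω]
  field_simp
  ring

/-- The partial sums of the Fourier series of `sawtooth`. -/
noncomputable def sawtoothPartial (T : ℕ) (x : UnitAddCircle) : ℝ :=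
  ∑ l ∈ Finset.range T, 2 / (Real.pi * (l + 1)) * circleSin (l + 1) x

/-- The squared norm of `sawtoothPartial`. -/
noncomputable def sawtoothEnergy (T : ℕ) : ℝ :=
  ∑ l ∈ Finset.range T, 2 / (Real.pi ^ 2 * ((l : ℝ) + 1) ^ 2)

lemma measurable_sawtoothPartial (T : ℕ) : Measurable (sawtoothPartial T) :=
  Finset.measurable_sum _ fun _ _ => (measurable_circleSin _).const_mul _

lemma exists_abs_sawtoothPartial_le (T : ℕ) : ∃ C, ∀ x, |sawtoothPartial T x| ≤ C := by
  refine ⟨∑ l ∈ Finset.range T, |2 / (Real.pi * ((l : ℝ) + 1))| * 1, fun x => ?_⟩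
  refine (Finset.abs_sum_le_sum_abs _ _).trans (Finset.sum_le_sum fun l _ => ?_)
  rw [abs_mul]
  exact mul_le_mul_of_nonneg_left (abs_circleSin_le _ _) (abs_nonneg _)

lemma integrable_circleSin (l : ℕ) : Integrable (circleSin l) :=
  integrable_of_measurable_of_abs_le (measurable_circleSin l) (abs_circleSin_le l)

lemma integrable_mul_circleSin {f : UnitAddCircle → ℝ} (hf : Measurable f) {C : ℝ}
    (hC : ∀ x, |f x| ≤ C) (l : ℕ) : Integrable fun x => f x * circleSin l x :=
  integrable_of_measurable_of_abs_le (C := C * 1) (hf.mul (measurable_circleSin l)) fun x => by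
    rw [abs_mul]
    exact mul_le_mul (hC x) (abs_circleSin_le l x) (abs_nonneg _) ((abs_nonneg _).trans (hC x))

lemma integral_sawtoothPartial (T : ℕ) : ∫ x, sawtoothPartial T x = 0 := by
  unfold sawtoothPartial
  rw [integral_finsetSum _ fun l _ => (integrable_circleSin _).const_mul _]
  simp [integral_const_mul, integral_circleSin]

lemma integral_mul_sawtoothPartial {f : UnitAddCircle → ℝ} (hf : Measurable f) {C : ℝ}
    (hC : ∀ x, |f x| ≤ C) (T : ℕ) : ∫ x, f x * sawtoothPartial T x =
      ∑ l ∈ Finset.range T, 2 / (Real.pi * ((l : ℝ) + 1)) * ∫ x, f x * circleSin (l + 1) x := by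
  have h : ∀ x, f x * sawtoothPartial T x =
      ∑ l ∈ Finset.range T, 2 / (Real.pi * ((l : ℝ) + 1)) * (f x * circleSin (l + 1) x) := fun x => by
    rw [sawtoothPartial, Finset.mul_sum]
    exact Finset.sum_congr rfl fun l _ => by ring
  simp_rw [h]
  rw [integral_finsetSum _ fun l _ => (integrable_mul_circleSin hf hC _).const_mul _]
  simp_rw [integral_const_mul]

lemma integral_sawtooth_mul_sawtoothPartial (T : ℕ) :
    ∫ x, sawtooth x * sawtoothPartial T x = sawtoothEnergy T := by
  rw [integral_mul_sawtoothPartial measurable_sawtooth abs_sawtooth_le, sawtoothEnergy]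
  refine Finset.sum_congr rfl fun l _ => ?_
  rw [integral_sawtooth_mul_circleSin l.succ_ne_zero]
  push_cast
  field_simp

lemma integral_sawtoothPartial_sq (T : ℕ) :
    ∫ x, sawtoothPartial T x ^ 2 = sawtoothEnergy T := by
  obtain ⟨C, hC⟩ := exists_abs_sawtoothPartial_le T
  simp_rw [sq]
  rw [integral_mul_sawtoothPartial (measurable_sawtoothPartial T) hC, sawtoothEnergy]
  refine Finset.sum_congr rfl fun l hl => ?_
  have h : ∫ x, sawtoothPartial T x * circleSin (l + 1) x = 1 / (Real.pi * (l + 1)) := by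
    simp_rw [mul_comm (sawtoothPartial T _)]
    rw [integral_mul_sawtoothPartial (measurable_circleSin _) (abs_circleSin_le _)]
    simp_rw [integral_circleSin_mul l.succ_ne_zero]
    rw [Finset.sum_eq_single l]
    · simp; field_simp
    · intro m _ hm
      rw [if_neg (by omega), mul_zero]
    · intro h; exact absurd hl h
  rw [h]
  field_simp

/-- Pythagoras: the partial sum is an orthogonal projection of the sawtooth, so its inner product
with the sawtooth equals its own squared norm. The factor `y` will be a value of the square-wave
approximation. -/
lemma integral_sawtooth_sub_sq (T : ℕ) (y : ℝ) :
    ∫ x, (sawtooth x - y * sawtoothPartial T x) ^ 2 =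
      (1 / 3 - sawtoothEnergy T) + (1 - y) ^ 2 * sawtoothEnergy T := by
  obtain ⟨C, hC⟩ := exists_abs_sawtoothPartial_le T
  have hC0 : 0 ≤ C := (abs_nonneg _).trans (hC 0)
  have h1 : ∀ x, (sawtooth x - y * sawtoothPartial T x) ^ 2 =
      sawtooth x ^ 2 - 2 * y * (sawtooth x * sawtoothPartial T x) +
        y ^ 2 * sawtoothPartial T x ^ 2 := fun x => by ring
  have i1 : Integrable fun x => sawtooth x ^ 2 :=
    integrable_of_measurable_of_abs_le (C := 1) (measurable_sawtooth.pow_const 2) fun x => by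
      rw [abs_pow]; exact pow_le_one₀ (abs_nonneg _) (abs_sawtooth_le x)
  have i2 : Integrable fun x => sawtooth x * sawtoothPartial T x :=
    integrable_of_measurable_of_abs_le (C := 1 * C)
      (measurable_sawtooth.mul (measurable_sawtoothPartial T)) fun x => by
        rw [abs_mul]; exact mul_le_mul (abs_sawtooth_le x) (hC x) (abs_nonneg _) zero_le_one
  have i3 : Integrable fun x => sawtoothPartial T x ^ 2 :=
    integrable_of_measurable_of_abs_le (C := C ^ 2)
      ((measurable_sawtoothPartial T).pow_const 2) fun x => by
        rw [abs_pow]; exact pow_le_pow_left₀ (abs_nonneg _) (hC x) 2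
  simp_rw [h1]
  have i12 : Integrable fun x => sawtooth x ^ 2 - 2 * y * (sawtooth x * sawtoothPartial T x) :=
    i1.sub (i2.const_mul _)
  rw [integral_add i12 (i3.const_mul _), integral_sub i1 (i2.const_mul _),
    integral_const_mul, integral_const_mul, integral_sawtooth_sq,
    integral_sawtooth_mul_sawtoothPartial, integral_sawtoothPartial_sq]
  ring

/-! ### Second moments of cyclic sums -/

/-- The pairs `{i, i + d}` with `1 ≤ d ≤ n` list each edge of the complete graph once. Two distinct
edges have a vertex belonging to the first alone, and integrating out that coordinate kills the
cross term. -/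
lemma integral_sq_cyclic_sum (n : ℕ) (G : ℕ → UnitAddCircle → ℝ) (C : ℝ)
    (hm : ∀ d, Measurable (G d)) (hC : ∀ d ∈ Finset.Icc 1 n, ∀ x, |G d x| ≤ C)
    (h0 : ∀ d, ∫ x, G d x = 0) :
    ∫ U : ZMod (2 * n + 1) → UnitAddCircle,
      (∑ i : ZMod (2 * n + 1), ∑ d ∈ Finset.Icc 1 n,
        G d (U (i + (d : ZMod (2 * n + 1))) - U i)) ^ 2 =
      (2 * n + 1) * ∑ d ∈ Finset.Icc 1 n, ∫ x, G d x ^ 2 := by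
  classical
  have hne : ∀ d ∈ Finset.Icc 1 n, ∀ i : ZMod (2 * n + 1), i + (d : ZMod (2 * n + 1)) ≠ i := by
    intro d hd i h
    rw [add_eq_left, ZMod.natCast_eq_zero_iff] at h
    have := Finset.mem_Icc.1 hd
    exact absurd (Nat.le_of_dvd (by omega) h) (by omega)
  set P := (Finset.univ : Finset (ZMod (2 * n + 1))) ×ˢ Finset.Icc 1 n with hP
  set E : ZMod (2 * n + 1) × ℕ → (ZMod (2 * n + 1) → UnitAddCircle) → ℝ := fun p U =>
    G p.2 (U (p.1 + (p.2 : ZMod (2 * n + 1))) - U p.1) with hE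
  have hEm : ∀ p, Measurable (E p) := fun p =>
    (hm p.2).comp ((measurable_pi_apply _).sub (measurable_pi_apply _))
  have hPd : ∀ p ∈ P, p.2 ∈ Finset.Icc 1 n := fun p hp => (Finset.mem_product.1 hp).2
  have hdiag : ∀ p ∈ P, ∫ U, E p U * E p U = ∫ x, G p.2 x ^ 2 := fun p hp => by
    rw [← integral_comp_sub_eq (hne p.2 (hPd p hp) p.1).symm (C := C ^ 2) ((hm p.2).pow_const 2)
      fun x => by
        rw [abs_pow]; exact pow_le_pow_left₀ (abs_nonneg _) (hC _ (hPd p hp) x) 2]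
    simp only [hE, sq]
  have hoff : ∀ p ∈ P, ∀ q ∈ P, q ≠ p → ∫ U, E p U * E q U = 0 := by
    rintro ⟨i, d⟩ hp ⟨k, e⟩ hq hpq
    have hd := hPd _ hp
    have he := hPd _ hq
    -- If the start `i` lies on the second edge, the end `i + d` does not; when `i = k + e` this
    -- uses `0 < d + e < 2 n + 1`.
    by_cases h1 : i = k ∨ i = k + (e : ZMod (2 * n + 1))
    · have h2 : i + (d : ZMod (2 * n + 1)) ≠ k ∧
          i + (d : ZMod (2 * n + 1)) ≠ k + (e : ZMod (2 * n + 1)) := by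
        simp only [Finset.mem_Icc] at hd he
        rcases h1 with h1 | h1
        · subst h1
          refine ⟨hne d (Finset.mem_Icc.2 hd) i, fun h => hpq ?_⟩
          rw [add_right_inj] at h
          have h3 := congrArg ZMod.val h
          rw [ZMod.val_cast_of_lt (by omega), ZMod.val_cast_of_lt (by omega)] at h3
          rw [h3]
        · subst h1
          constructor
          · intro h
            rw [add_assoc, add_eq_left, ← Nat.cast_add, ZMod.natCast_eq_zero_iff] at h
            exact absurd (Nat.le_of_dvd (by omega) h) (by omega)
          · exact hne d (Finset.mem_Icc.2 hd) _
      exact integral_mul_comp_sub_eq_zero_of_notMem_right (hne d hd i) h2.1 h2.2 (hm d) (hm e)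
        (hC d hd) (hC e he) (h0 d)
    · push Not at h1
      exact integral_mul_comp_sub_eq_zero_of_notMem_left (hne d hd i) h1.1 h1.2 (hm d) (hm e)
        (hC d hd) (hC e he) (h0 d)
  have hint : ∀ p ∈ P, ∀ q ∈ P, Integrable fun U => E p U * E q U := fun p hp q hq =>
    integrable_of_measurable_of_abs_le (C := C * C) ((hEm p).mul (hEm q)) fun U => by
      rw [abs_mul]
      exact mul_le_mul (hC _ (hPd p hp) _) (hC _ (hPd q hq) _) (abs_nonneg _)
        ((abs_nonneg _).trans (hC _ (hPd p hp) 0))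
  have hsq : ∀ U, (∑ i : ZMod (2 * n + 1), ∑ d ∈ Finset.Icc 1 n,
      G d (U (i + (d : ZMod (2 * n + 1))) - U i)) ^ 2 = ∑ p ∈ P, ∑ q ∈ P, E p U * E q U := fun U => by
    rw [sq, ← Finset.sum_product', Finset.sum_mul_sum]
  simp_rw [hsq]
  rw [integral_finsetSum _ fun p hp => integrable_finsetSum _ fun q hq => hint p hp q hq]
  have h3 : ∀ p ∈ P, ∫ U, ∑ q ∈ P, E p U * E q U = ∫ x, G p.2 x ^ 2 := fun p hp => by
    rw [integral_finsetSum _ fun q hq => hint p hp q hq, Finset.sum_eq_single p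
      (fun q hq hqp => hoff p hp q hq hqp) (fun h => absurd hp h), hdiag p hp]
  rw [Finset.sum_congr rfl h3, hP, Finset.sum_product]
  simp [ZMod.card]

/-! ### Odd characters of `ℤ/(2n+1)` and the discrete square wave -/

/-- The character `j ↦ exp (2 π i (2 k + 1) j / (2 n + 1))` of `ℤ/(2n+1)`. -/
noncomputable def oddChar (n k : ℕ) (j : ZMod (2 * n + 1)) : ℂ :=
  ZMod.stdAddChar (((2 * k + 1 : ℕ) : ZMod (2 * n + 1)) * j)

lemma oddChar_natCast (n k d : ℕ) : oddChar n k (d : ZMod (2 * n + 1)) =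
    Complex.exp (((2 * Real.pi * (2 * k + 1) / (2 * n + 1) * d : ℝ) : ℂ) * Complex.I) := by
  have h : ((2 * k + 1 : ℕ) : ZMod (2 * n + 1)) * (d : ZMod (2 * n + 1)) =
      (((2 * k + 1) * d : ℤ) : ZMod (2 * n + 1)) := by push_cast; ring
  rw [oddChar, h, ZMod.stdAddChar_coe]
  congr 1
  push_cast
  ring

lemma norm_oddChar (n k : ℕ) (j : ZMod (2 * n + 1)) : ‖oddChar n k j‖ = 1 :=
  AddChar.norm_apply _ _

lemma oddChar_zero (n k : ℕ) : oddChar n k 0 = 1 := by simp [oddChar]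

lemma oddChar_sub (n k : ℕ) (i j : ZMod (2 * n + 1)) :
    oddChar n k (i - j) = oddChar n k i * (starRingEnd ℂ) (oddChar n k j) := by
  rw [oddChar, oddChar, oddChar, mul_sub, sub_eq_add_neg, AddChar.map_add_eq_mul,
    AddChar.map_neg_eq_conj]

lemma sum_stdAddChar_mul (n : ℕ) (a : ZMod (2 * n + 1)) :
    ∑ j : ZMod (2 * n + 1), ZMod.stdAddChar (a * j) = if a = 0 then (2 * n + 1 : ℂ) else 0 := by
  have h := AddChar.sum_mulShift a (ZMod.isPrimitive_stdAddChar (2 * n + 1))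
  simp_rw [mul_comm a]
  rw [h]
  split_ifs <;> simp [ZMod.card]

/-- The frequencies add up to `2 (k + l + 1)`, strictly between `0` and `2 n + 1`, so the product is
a nontrivial character: no aliasing. -/
lemma sum_oddChar_mul {n k l : ℕ} (h : k + l + 1 ≤ n) :
    ∑ j, oddChar n k j * oddChar n l j = 0 := by
  have h1 : ∀ j, oddChar n k j * oddChar n l j =
      ZMod.stdAddChar (((2 * (k + l + 1) : ℕ) : ZMod (2 * n + 1)) * j) := fun j => by
    rw [oddChar, oddChar, ← AddChar.map_add_eq_mul]
    congr 1
    push_cast; ring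
  simp_rw [h1]
  rw [sum_stdAddChar_mul, if_neg]
  rw [ZMod.natCast_eq_zero_iff]
  exact fun h' => absurd (Nat.le_of_dvd (by omega) h') (by omega)

lemma sum_oddChar_mul_conj {n k l : ℕ} (hk : k < n) (hl : l < n) :
    ∑ j, oddChar n k j * (starRingEnd ℂ) (oddChar n l j) = if k = l then (2 * n + 1 : ℂ) else 0 := by
  have h1 : ∀ j, oddChar n k j * (starRingEnd ℂ) (oddChar n l j) =
      ZMod.stdAddChar ((((2 * k + 1 : ℕ) : ZMod (2 * n + 1)) -
        ((2 * l + 1 : ℕ) : ZMod (2 * n + 1))) * j) := fun j => by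
    rw [oddChar, oddChar, ← AddChar.map_neg_eq_conj, ← AddChar.map_add_eq_mul]
    congr 1
    ring
  simp_rw [h1]
  rw [sum_stdAddChar_mul]
  refine if_congr ⟨fun h => ?_, fun h => by rw [h, sub_self]⟩ rfl rfl
  have h2 := congrArg ZMod.val (sub_eq_zero.1 h)
  rw [ZMod.val_cast_of_lt (by omega), ZMod.val_cast_of_lt (by omega)] at h2
  omega

lemma sum_oddChar_im_mul_im {n k l : ℕ} (h : k + l + 1 ≤ n) :
    ∑ j, (oddChar n k j).im * (oddChar n l j).im = if k = l then (2 * n + 1 : ℝ) / 2 else 0 := by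
  have h1 : ∀ j, (oddChar n k j).im * (oddChar n l j).im =
      (1 / 2) * ((oddChar n k j * (starRingEnd ℂ) (oddChar n l j)).re -
        (oddChar n k j * oddChar n l j).re) := fun j => by
    simp only [Complex.mul_re, Complex.conj_re, Complex.conj_im]
    ring
  simp_rw [h1]
  rw [← Finset.mul_sum, Finset.sum_sub_distrib, ← Complex.re_sum, ← Complex.re_sum,
    sum_oddChar_mul h, sum_oddChar_mul_conj (by omega) (by omega)]
  split_ifs
  · simp; ring
  · simp

/-- A sum over `ℤ/(2n+1)`, arranged as `0, ±1, …, ±n`. -/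
lemma sum_zmod_eq (n : ℕ) (f : ZMod (2 * n + 1) → ℝ) :
    ∑ j, f j = f 0 + ∑ d ∈ Finset.Icc 1 n,
      (f (d : ZMod (2 * n + 1)) + f (-(d : ZMod (2 * n + 1)))) := by
  have h1 : ∑ j, f j = ∑ m ∈ Finset.range (2 * n + 1), f (m : ZMod (2 * n + 1)) := by
    refine Finset.sum_nbij' (fun j => j.val) (fun m => (m : ZMod (2 * n + 1))) ?_ ?_ ?_ ?_ ?_
    · intro j _; exact Finset.mem_range.2 (ZMod.val_lt j)
    · intro m _; exact Finset.mem_univ _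
    · intro j _; exact ZMod.natCast_zmod_val j
    · intro m hm; exact ZMod.val_cast_of_lt (Finset.mem_range.1 hm)
    · intro j _; rw [ZMod.natCast_zmod_val]
  have h2 : Finset.range (2 * n + 1) = insert 0 (Finset.Icc 1 n ∪ Finset.Icc (n + 1) (2 * n)) := by
    ext m; simp only [Finset.mem_range, Finset.mem_insert, Finset.mem_union, Finset.mem_Icc]; omega
  have h3 : ∑ m ∈ Finset.Icc (n + 1) (2 * n), f (m : ZMod (2 * n + 1)) =
      ∑ d ∈ Finset.Icc 1 n, f (-(d : ZMod (2 * n + 1))) := by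
    refine Finset.sum_nbij' (fun m => 2 * n + 1 - m) (fun d => 2 * n + 1 - d) ?_ ?_ ?_ ?_ ?_
    · intro m hm; simp only [Finset.mem_Icc] at hm ⊢; omega
    · intro m hm; simp only [Finset.mem_Icc] at hm ⊢; omega
    · intro m hm; simp only [Finset.mem_Icc] at hm ⊢; omega
    · intro m hm; simp only [Finset.mem_Icc] at hm ⊢; omega
    · intro m hm
      simp only [Finset.mem_Icc] at hm
      rw [Nat.cast_sub (by omega), ZMod.natCast_self, zero_sub, neg_neg]
  rw [h1, h2, Finset.sum_insert (by simp), Finset.sum_union, h3, Finset.sum_add_distrib]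
  · simp
  · rw [Finset.disjoint_left]
    intro m hm hm'
    simp only [Finset.mem_Icc] at hm hm'
    omega

/-- Every off-diagonal ordered pair is `(i, i + d)` or `(i, i - d)` for a unique `d` in `1, …, n`,
and symmetry identifies the two halves. -/
lemma sum_sum_zmod_eq (n : ℕ) (g : ZMod (2 * n + 1) → ZMod (2 * n + 1) → ℝ)
    (hs : ∀ i j, g i j = g j i) (h0 : ∀ i, g i i = 0) :
    ∑ i, ∑ j, g i j =
      2 * ∑ i, ∑ d ∈ Finset.Icc 1 n, g i (i + (d : ZMod (2 * n + 1))) := by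
  have h1 : ∀ i, ∑ j, g i j = ∑ d ∈ Finset.Icc 1 n, g i (i + (d : ZMod (2 * n + 1))) +
      ∑ d ∈ Finset.Icc 1 n, g i (i + -(d : ZMod (2 * n + 1))) := fun i => by
    rw [← Equiv.sum_comp (Equiv.addLeft i)]
    simp only [Equiv.coe_addLeft]
    rw [sum_zmod_eq, add_zero, h0, zero_add, Finset.sum_add_distrib]
  have h2 : ∑ i, ∑ d ∈ Finset.Icc 1 n, g i (i + -(d : ZMod (2 * n + 1))) =
      ∑ i, ∑ d ∈ Finset.Icc 1 n, g i (i + (d : ZMod (2 * n + 1))) := by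
    rw [Finset.sum_comm, Finset.sum_comm (s := (Finset.univ : Finset (ZMod (2 * n + 1))))]
    refine Finset.sum_congr rfl fun d _ => ?_
    rw [← Equiv.sum_comp (Equiv.addRight (d : ZMod (2 * n + 1)))]
    refine Finset.sum_congr rfl fun i _ => ?_
    simp only [Equiv.coe_addRight]
    rw [add_neg_cancel_right, hs]
  simp_rw [h1]
  rw [Finset.sum_add_distrib, h2]
  ring

/-- The partial sums of the Fourier series of the square wave, on `ℤ/(2n+1)`. -/
noncomputable def squarePartial (n T : ℕ) (j : ZMod (2 * n + 1)) : ℝ :=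
  ∑ k ∈ Finset.range T, 4 / (Real.pi * (2 * k + 1)) * (oddChar n k j).im

/-- The squared norm of the partial sums of the square wave. -/
noncomputable def squareEnergy (T : ℕ) : ℝ :=
  ∑ k ∈ Finset.range T, 8 / (Real.pi ^ 2 * (2 * (k : ℝ) + 1) ^ 2)

lemma oddChar_im_neg (n k : ℕ) (j : ZMod (2 * n + 1)) :
    (oddChar n k (-j)).im = -(oddChar n k j).im := by
  have h := oddChar_sub n k 0 j
  rw [zero_sub, oddChar_zero, one_mul] at h
  rw [h, Complex.conj_im]

lemma squarePartial_neg (n T : ℕ) (j : ZMod (2 * n + 1)) :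
    squarePartial n T (-j) = -squarePartial n T j := by
  simp only [squarePartial, oddChar_im_neg, mul_neg, Finset.sum_neg_distrib]

/-- Parseval on `ℤ/(2n+1)`, halved because the function is odd; `2 * T ≤ n` keeps the sines
orthogonal. -/
lemma sum_squarePartial_sq {n T : ℕ} (h : 2 * T ≤ n) :
    ∑ d ∈ Finset.Icc 1 n, squarePartial n T (d : ZMod (2 * n + 1)) ^ 2 =
      (2 * n + 1) / 2 * squareEnergy T := by
  have h1 : ∑ j, squarePartial n T j ^ 2 = (2 * n + 1) * squareEnergy T := by
    have h2 : ∀ j, squarePartial n T j ^ 2 = ∑ k ∈ Finset.range T, ∑ l ∈ Finset.range T,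
        4 / (Real.pi * (2 * (k : ℝ) + 1)) * (4 / (Real.pi * (2 * (l : ℝ) + 1))) *
          ((oddChar n k j).im * (oddChar n l j).im) := fun j => by
      rw [squarePartial, sq, Finset.sum_mul_sum]
      exact Finset.sum_congr rfl fun k _ => Finset.sum_congr rfl fun l _ => by ring
    simp_rw [h2]
    rw [Finset.sum_comm, squareEnergy, Finset.mul_sum]
    refine Finset.sum_congr rfl fun k hk => ?_
    rw [Finset.sum_comm, Finset.sum_eq_single k]
    · rw [← Finset.mul_sum, sum_oddChar_im_mul_im (by rw [Finset.mem_range] at hk; omega),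
        if_pos rfl]
      field_simp
      ring
    · intro l hl hlk
      rw [Finset.mem_range] at hk hl
      rw [← Finset.mul_sum, sum_oddChar_im_mul_im (by omega), if_neg (Ne.symm hlk), mul_zero]
    · intro h'; exact absurd hk h'
  rw [sum_zmod_eq] at h1
  have h3 : squarePartial n T 0 = 0 := by simp [squarePartial, oddChar_zero]
  simp only [squarePartial_neg, h3, neg_sq, ← two_mul, ← Finset.mul_sum] at h1
  linarith

/-! ### Mean square error of the truncated kernel. -/

lemma two_mul_sin_mul_sum_sin (θ : ℝ) (n : ℕ) :
    2 * Real.sin (θ / 2) * ∑ d ∈ Finset.Icc 1 n, Real.sin (θ * d) =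
      Real.cos (θ / 2) - Real.cos (θ * n + θ / 2) := by
  induction n with
  | zero => simp
  | succ n ih =>
    rw [Finset.sum_Icc_succ_top (by omega), mul_add, ih]
    have h1 : θ * n + θ / 2 = θ * (n + 1 : ℕ) - θ / 2 := by push_cast; ring
    rw [h1, Real.cos_sub, Real.cos_add]
    ring

lemma tendsto_sum_oddChar_im (k : ℕ) :
    Tendsto (fun n : ℕ => (∑ d ∈ Finset.Icc 1 n, (oddChar n k (d : ZMod (2 * n + 1))).im) /
      (2 * n + 1)) atTop (𝓝 (1 / (Real.pi * (2 * k + 1)))) := by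
  have hpi := Real.pi_pos
  set m : ℝ := 2 * k + 1 with hm
  have hm0 : 0 < m := by positivity
  have hx : Tendsto (fun n : ℕ => Real.pi * m / (2 * n + 1)) atTop (𝓝 0) := by
    refine tendsto_const_nhds.div_atTop ?_
    exact tendsto_atTop_add_const_right _ _
      (tendsto_natCast_atTop_atTop.const_mul_atTop two_pos)
  have h1 : Tendsto (fun n : ℕ => (Real.cos (Real.pi * m / (2 * n + 1)) + 1) /
      (2 * (Real.pi * m * Real.sinc (Real.pi * m / (2 * n + 1))))) atTop
      (𝓝 ((Real.cos 0 + 1) / (2 * (Real.pi * m * Real.sinc 0)))) := by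
    refine Tendsto.div (((Real.continuous_cos.tendsto 0).comp hx).add_const 1)
      ((((Real.continuous_sinc.tendsto 0).comp hx).const_mul _).const_mul 2) ?_
    simp [hpi.ne', hm0.ne']
  have h2 : (Real.cos 0 + 1) / (2 * (Real.pi * m * Real.sinc 0)) = 1 / (Real.pi * m) := by
    simp only [Real.cos_zero, Real.sinc_zero]
    field_simp
    norm_num
  rw [h2] at h1
  refine h1.congr' ?_
  filter_upwards [eventually_ge_atTop (2 * k + 1)] with n hn
  have hN : (0 : ℝ) < 2 * n + 1 := by positivity
  have hn' : m < 2 * n + 1 := by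
    have : ((2 * k + 1 : ℕ) : ℝ) ≤ n := by exact_mod_cast hn
    push_cast at this
    rw [hm]; linarith
  set x := Real.pi * m / (2 * n + 1) with hxdef
  have hx0 : 0 < x := by positivity
  have hxpi : x < Real.pi := by
    rw [hxdef, div_lt_iff₀ hN]
    exact mul_lt_mul_of_pos_left hn' hpi
  have hsin : 0 < Real.sin x := Real.sin_pos_of_pos_of_lt_pi hx0 hxpi
  have h3 : ∀ d : ℕ, (oddChar n k (d : ZMod (2 * n + 1))).im = Real.sin (2 * x * d) := fun d => by
    rw [oddChar_natCast, Complex.exp_ofReal_mul_I_im]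
    congr 1
    rw [hxdef, hm]
    field_simp
  have h4 := two_mul_sin_mul_sum_sin (2 * x) n
  -- The phase is `x (2 n + 1) = π (2 k + 1)`, an odd multiple of `π`.
  have h5 : Real.cos (2 * x * n + 2 * x / 2) = -1 := by
    have : 2 * x * n + 2 * x / 2 = (k : ℝ) * (2 * Real.pi) + Real.pi := by
      rw [hxdef, hm]; field_simp
    rw [this, Real.cos_nat_mul_two_pi_add_pi]
  rw [h5, show 2 * x / 2 = x by ring] at h4
  simp_rw [h3]
  rw [Real.sinc_of_ne_zero hx0.ne']
  have h6 : Real.pi * m = x * (2 * n + 1) := by rw [hxdef]; field_simp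
  rw [h6]
  have h7 : ∑ d ∈ Finset.Icc 1 n, Real.sin (2 * x * d) = (Real.cos x + 1) / (2 * Real.sin x) := by
    rw [eq_div_iff (by positivity)]; linarith
  rw [h7]
  field_simp

/-- Expanding the square, the cross term tends to `-2` times `squareEnergy T` and the quadratic term
to `squareEnergy T`, as for a projection. The factor `2 n / (2 n + 1)` converts between the
normalizations `1 / n` and `2 / (2 n + 1)`. -/
lemma tendsto_sum_one_sub_squarePartial_sq (T : ℕ) :
    Tendsto (fun n : ℕ => (∑ d ∈ Finset.Icc 1 n,
      (1 - 2 * n / (2 * n + 1) * squarePartial n T (d : ZMod (2 * n + 1))) ^ 2) / (n : ℝ))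
      atTop (𝓝 (1 - squareEnergy T)) := by
  have hr : Tendsto (fun n : ℕ => (n : ℝ) / (2 * n + 1)) atTop (𝓝 (1 / 2)) := by
    have h1 : Tendsto (fun n : ℕ => 1 / (2 + 1 / (n : ℝ))) atTop (𝓝 (1 / (2 + 0))) :=
      tendsto_const_nhds.div (tendsto_const_nhds.add tendsto_one_div_atTop_nhds_zero_nat)
        (by norm_num)
    rw [add_zero] at h1
    refine h1.congr' ?_
    filter_upwards [eventually_gt_atTop 0] with n hn
    have : (n : ℝ) ≠ 0 := by positivity
    field_simp
  have hlin : Tendsto (fun n : ℕ => (∑ d ∈ Finset.Icc 1 n,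
      squarePartial n T (d : ZMod (2 * n + 1))) / (2 * n + 1)) atTop (𝓝 (squareEnergy T / 2)) := by
    have h1 : Tendsto (fun n : ℕ => ∑ k ∈ Finset.range T, 4 / (Real.pi * (2 * (k : ℝ) + 1)) *
        ((∑ d ∈ Finset.Icc 1 n, (oddChar n k (d : ZMod (2 * n + 1))).im) / (2 * n + 1))) atTop
        (𝓝 (∑ k ∈ Finset.range T, 4 / (Real.pi * (2 * (k : ℝ) + 1)) *
          (1 / (Real.pi * (2 * k + 1))))) :=
      tendsto_finsetSum _ fun k _ => (tendsto_sum_oddChar_im k).const_mul _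
    have h2 : ∑ k ∈ Finset.range T, 4 / (Real.pi * (2 * (k : ℝ) + 1)) *
          (1 / (Real.pi * (2 * k + 1))) = squareEnergy T / 2 := by
      rw [squareEnergy, Finset.sum_div]
      refine Finset.sum_congr rfl fun k _ => ?_
      field_simp
      ring
    rw [h2] at h1
    refine h1.congr fun n => ?_
    simp only [squarePartial]
    rw [Finset.sum_comm, Finset.sum_div]
    refine Finset.sum_congr rfl fun k _ => ?_
    rw [← Finset.mul_sum, mul_div_assoc]
  have h3 : Tendsto (fun n : ℕ => 1 - 4 * ((∑ d ∈ Finset.Icc 1 n,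
      squarePartial n T (d : ZMod (2 * n + 1))) / (2 * n + 1)) +
        2 * ((n : ℝ) / (2 * n + 1)) * squareEnergy T) atTop
      (𝓝 (1 - 4 * (squareEnergy T / 2) + 2 * (1 / 2) * squareEnergy T)) :=
    (tendsto_const_nhds.sub (hlin.const_mul 4)).add ((hr.const_mul 2).mul_const _)
  have h4 : 1 - 4 * (squareEnergy T / 2) + 2 * (1 / 2) * squareEnergy T = 1 - squareEnergy T := by
    ring
  rw [h4] at h3
  refine h3.congr' ?_
  filter_upwards [eventually_ge_atTop (2 * T), eventually_gt_atTop 0] with n hn hn0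
  have hn0' : (n : ℝ) ≠ 0 := by positivity
  have h5 : ∀ d ∈ Finset.Icc 1 n,
      (1 - 2 * n / (2 * n + 1) * squarePartial n T (d : ZMod (2 * n + 1))) ^ 2 =
      1 - 4 * n / (2 * n + 1) * squarePartial n T (d : ZMod (2 * n + 1)) +
        (2 * n / (2 * n + 1)) ^ 2 * squarePartial n T (d : ZMod (2 * n + 1)) ^ 2 := fun d _ => by
    ring
  rw [Finset.sum_congr rfl h5, Finset.sum_add_distrib, Finset.sum_sub_distrib, ← Finset.mul_sum,
    ← Finset.mul_sum, sum_squarePartial_sq hn]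
  simp only [Finset.sum_const, Nat.card_Icc, add_tsub_cancel_right, nsmul_eq_mul, mul_one]
  field_simp

/-- The approximation of the normalized writhe by a quadratic form in finitely many
trigonometric sums. -/
noncomputable def writheApprox (n T : ℕ) (U : ZMod (2 * n + 1) → UnitAddCircle) : ℝ :=
  2 / (2 * n + 1) * ∑ i, ∑ d ∈ Finset.Icc 1 n, squarePartial n T (d : ZMod (2 * n + 1)) *
    sawtoothPartial T (U (i + (d : ZMod (2 * n + 1))) - U i)

lemma integral_sq_writhe_sub_writheApprox {n : ℕ} (hn : 0 < n) (T : ℕ) :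
    ∫ U : ZMod (2 * n + 1) → UnitAddCircle,
      (writhe n (circleLift ∘ U) / n - writheApprox n T U) ^ 2 =
      (2 + 1 / n) * ((1 / 3 - sawtoothEnergy T) + sawtoothEnergy T * ((∑ d ∈ Finset.Icc 1 n,
        (1 - 2 * n / (2 * n + 1) * squarePartial n T (d : ZMod (2 * n + 1))) ^ 2) / n)) := by
  have hn0 : (n : ℝ) ≠ 0 := by positivity
  obtain ⟨C, hC⟩ := exists_abs_sawtoothPartial_le T
  set y : ℕ → ℝ := fun d => 2 * n / (2 * n + 1) * squarePartial n T (d : ZMod (2 * n + 1)) with hy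
  have h1 : ∀ U : ZMod (2 * n + 1) → UnitAddCircle,
      (writhe n (circleLift ∘ U) / n - writheApprox n T U) ^ 2 = (1 / n) ^ 2 *
        (∑ i : ZMod (2 * n + 1), ∑ d ∈ Finset.Icc 1 n,
          (sawtooth (U (i + (d : ZMod (2 * n + 1))) - U i) -
            y d * sawtoothPartial T (U (i + (d : ZMod (2 * n + 1))) - U i))) ^ 2 := fun U => by
    rw [← mul_pow, writhe_circleLift_eq, writheApprox]
    simp only [Finset.sum_sub_distrib, hy, mul_assoc, ← Finset.mul_sum]
    field_simp
  simp_rw [h1]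
  rw [integral_const_mul, integral_sq_cyclic_sum n
    (fun d x => sawtooth x - y d * sawtoothPartial T x)
    (1 + (∑ d ∈ Finset.Icc 1 n, |y d|) * C)
    (fun d => measurable_sawtooth.sub ((measurable_sawtoothPartial T).const_mul _))
    (fun d hd x => ?_) (fun d => ?_)]
  · simp_rw [integral_sawtooth_sub_sq]
    rw [Finset.sum_add_distrib, ← Finset.sum_mul]
    simp only [Finset.sum_const, Nat.card_Icc, add_tsub_cancel_right, nsmul_eq_mul]
    change _ = (2 + 1 / (n : ℝ)) * ((1 / 3 - sawtoothEnergy T) + sawtoothEnergy T *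
      ((∑ d ∈ Finset.Icc 1 n, (1 - y d) ^ 2) / n))
    generalize ∑ d ∈ Finset.Icc 1 n, (1 - y d) ^ 2 = Z
    field_simp
  · refine (abs_sub _ _).trans (add_le_add (abs_sawtooth_le x) ?_)
    rw [abs_mul]
    exact mul_le_mul (Finset.single_le_sum (f := fun d => |y d|) (fun d _ => abs_nonneg _) hd)
      (hC x) (abs_nonneg _) (Finset.sum_nonneg fun d _ => abs_nonneg _)
  · rw [integral_sub (integrable_of_measurable_of_abs_le measurable_sawtooth abs_sawtooth_le)
      ((integrable_of_measurable_of_abs_le (measurable_sawtoothPartial T) hC).const_mul _),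
      integral_const_mul, integral_sawtooth, integral_sawtoothPartial]
    simp

/-- The limit of the mean square error of `writheApprox`. -/
noncomputable def approxError (T : ℕ) : ℝ :=
  2 * ((1 / 3 - sawtoothEnergy T) + sawtoothEnergy T * (1 - squareEnergy T))

lemma tendsto_integral_sq_writhe_sub_writheApprox (T : ℕ) :
    Tendsto (fun n : ℕ => ∫ U : ZMod (2 * n + 1) → UnitAddCircle,
      (writhe n (circleLift ∘ U) / n - writheApprox n T U) ^ 2) atTop (𝓝 (approxError T)) := by
  have h1 : Tendsto (fun n : ℕ => 2 + 1 / (n : ℝ)) atTop (𝓝 (2 + 0)) :=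
    tendsto_const_nhds.add tendsto_one_div_atTop_nhds_zero_nat
  rw [add_zero] at h1
  refine (h1.mul (tendsto_const_nhds.add
    ((tendsto_sum_one_sub_squarePartial_sq T).const_mul _))).congr' ?_
  filter_upwards [eventually_gt_atTop 0] with n hn
  rw [integral_sq_writhe_sub_writheApprox hn]

/-- Parseval for both series: the energies increase to the squared norms `1/3` of the sawtooth and
`1` of the square wave, by the value of `ζ(2)`. -/
lemma tendsto_approxError : Tendsto approxError atTop (𝓝 0) := by
  have hA : Tendsto sawtoothEnergy atTop (𝓝 (1 / 3)) := by
    have h1 := ((hasSum_one_div_add_one_pow one_ne_zero).mul_left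
      (2 / Real.pi ^ 2)).tendsto_sum_nat
    convert h1 using 2
    · unfold sawtoothEnergy
      refine Finset.sum_congr rfl fun l _ => ?_
      rw [mul_one]
      field_simp
    · norm_num [bernoulli_two, Nat.factorial]
      field_simp
      norm_num
  have hB : Tendsto squareEnergy atTop (𝓝 1) := by
    have h1 := ((hasSum_one_div_odd_pow one_ne_zero).mul_left
      (8 / Real.pi ^ 2)).tendsto_sum_nat
    convert h1 using 2
    · unfold squareEnergy
      refine Finset.sum_congr rfl fun l _ => ?_
      rw [mul_one]
      field_simp
    · norm_num [bernoulli_two, Nat.factorial]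
      field_simp
      norm_num
  unfold approxError
  have h := ((tendsto_const_nhds (x := (1 / 3 : ℝ)).sub hA).add
    (hA.mul (tendsto_const_nhds (x := (1 : ℝ)).sub hB))).const_mul 2
  simpa using h

/-! ### A central limit theorem for bounded arrays on the circle -/

lemma norm_prod_sub_prod_le {ι : Type*} (s : Finset ι) (a b : ι → ℂ) (ha : ∀ i ∈ s, ‖a i‖ ≤ 1)
    (hb : ∀ i ∈ s, ‖b i‖ ≤ 1) : ‖∏ i ∈ s, a i - ∏ i ∈ s, b i‖ ≤ ∑ i ∈ s, ‖a i - b i‖ := by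
  classical
  induction s using Finset.induction_on with
  | empty => simp
  | insert i s hi ih =>
    rw [Finset.prod_insert hi, Finset.prod_insert hi, Finset.sum_insert hi]
    have h1 : a i * ∏ x ∈ s, a x - b i * ∏ x ∈ s, b x =
        (a i - b i) * ∏ x ∈ s, a x + b i * (∏ x ∈ s, a x - ∏ x ∈ s, b x) := by ring
    rw [h1]
    refine (norm_add_le _ _).trans (add_le_add ?_ ?_)
    · rw [norm_mul, norm_prod]
      refine mul_le_of_le_one_right (norm_nonneg _) ?_
      exact Finset.prod_le_one (fun _ _ => norm_nonneg _)
        fun x hx => ha x (Finset.mem_insert_of_mem hx)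
    · rw [norm_mul]
      refine (mul_le_of_le_one_left (norm_nonneg _) (hb i (Finset.mem_insert_self i s))).trans ?_
      exact ih (fun x hx => ha x (Finset.mem_insert_of_mem hx))
        fun x hx => hb x (Finset.mem_insert_of_mem hx)

lemma norm_exp_mul_I_sub_le {y : ℝ} (hy : |y| ≤ 1) :
    ‖Complex.exp (y * Complex.I) - (1 + y * Complex.I - (y : ℂ) ^ 2 / 2)‖ ≤ |y| ^ 3 := by
  have hn : ‖(y : ℂ) * Complex.I‖ = |y| := by simp
  have h := Complex.exp_bound (x := (y : ℂ) * Complex.I) (by rw [hn]; exact hy) (n := 3) (by norm_num)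
  have h1 : ∑ m ∈ Finset.range 3, ((y : ℂ) * Complex.I) ^ m / (m.factorial : ℂ) =
      1 + y * Complex.I - (y : ℂ) ^ 2 / 2 := by
    simp only [Finset.sum_range_succ, Finset.sum_range_zero, Nat.factorial, mul_pow, Complex.I_sq]
    push_cast; ring
  rw [h1, hn] at h
  refine h.trans (mul_le_of_le_one_right (by positivity) ?_)
  norm_num [Nat.factorial]

/-- The characteristic function of a small bounded centered variable, to second order. -/
lemma norm_integral_exp_sub_exp_le {Y : UnitAddCircle → ℝ} {C h : ℝ} (hY : Measurable Y)
    (hC : ∀ x, |Y x| ≤ C) (h0 : ∫ x, Y x = 0) (hh : 0 ≤ h) (hCh : C * h ≤ 1) :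
    ‖(∫ x, Complex.exp (((h * Y x : ℝ) : ℂ) * Complex.I)) -
      ((Real.exp (-(h ^ 2 * ∫ x, Y x ^ 2) / 2) : ℝ) : ℂ)‖ ≤ (C * h) ^ 3 + (C * h) ^ 4 := by
  have hC0 : 0 ≤ C := (abs_nonneg _).trans (hC 0)
  have hCh0 : 0 ≤ C * h := mul_nonneg hC0 hh
  set m := ∫ x, Y x ^ 2 with hm
  have hYi : Integrable Y := integrable_of_measurable_of_abs_le hY hC
  have hY2 : Integrable fun x => Y x ^ 2 :=
    integrable_of_measurable_of_abs_le (C := C ^ 2) (hY.pow_const 2) fun x => by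
      rw [abs_pow]; exact pow_le_pow_left₀ (abs_nonneg _) (hC x) 2
  have hm0 : 0 ≤ m := integral_nonneg fun x => sq_nonneg _
  have hmC : m ≤ C ^ 2 := by
    have h1 : m ≤ ∫ _ : UnitAddCircle, C ^ 2 :=
      integral_mono hY2 (integrable_const _) fun x => by
        have := pow_le_pow_left₀ (abs_nonneg _) (hC x) 2
        simpa [sq_abs] using this
    simpa using h1
  have hi1 : Integrable fun x => Complex.exp (((h * Y x : ℝ) : ℂ) * Complex.I) :=
    Integrable.of_bound (by fun_prop) 1 (ae_of_all _ fun x => by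
      rw [Complex.norm_exp_ofReal_mul_I])
  have hi2 : Integrable fun x => (1 + ((h * Y x : ℝ) : ℂ) * Complex.I -
      ((h * Y x : ℝ) : ℂ) ^ 2 / 2) := by
    refine ((integrable_const _).add ((hYi.const_mul h).ofReal.mul_const _)).sub ?_
    have := ((hY2.const_mul (h ^ 2)).ofReal (𝕜 := ℂ)).div_const 2
    refine this.congr (ae_of_all _ fun x => ?_)
    simp only [Complex.coe_algebraMap, ← Complex.ofReal_pow, mul_pow]
  have h2 : ∫ x, (1 + ((h * Y x : ℝ) : ℂ) * Complex.I - ((h * Y x : ℝ) : ℂ) ^ 2 / 2) =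
      ((1 - h ^ 2 * m / 2 : ℝ) : ℂ) := by
    have e1 : Integrable fun x => (1 : ℂ) + ((h * Y x : ℝ) : ℂ) * Complex.I :=
      (integrable_const _).add ((hYi.const_mul h).ofReal.mul_const _)
    have e2 : Integrable fun x => (((h ^ 2 / 2 * Y x ^ 2 : ℝ)) : ℂ) := (hY2.const_mul _).ofReal
    have e3 : ∀ x, (1 + ((h * Y x : ℝ) : ℂ) * Complex.I - ((h * Y x : ℝ) : ℂ) ^ 2 / 2) =
        (1 + ((h * Y x : ℝ) : ℂ) * Complex.I) - (((h ^ 2 / 2 * Y x ^ 2 : ℝ)) : ℂ) := fun x => by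
      push_cast; ring
    simp_rw [e3]
    rw [integral_sub e1 e2, integral_add (integrable_const _) ((hYi.const_mul h).ofReal.mul_const _),
      integral_mul_const, integral_complex_ofReal, integral_complex_ofReal, integral_const_mul,
      integral_const_mul, h0, ← hm]
    simp
    ring
  have h3 : ‖(∫ x, Complex.exp (((h * Y x : ℝ) : ℂ) * Complex.I)) - ((1 - h ^ 2 * m / 2 : ℝ) : ℂ)‖ ≤
      (C * h) ^ 3 := by
    rw [← h2, ← integral_sub hi1 hi2]
    refine (norm_integral_le_of_norm_le_const (C := (C * h) ^ 3) (ae_of_all _ fun x => ?_)).trans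
      (by simp)
    have h4 : |h * Y x| ≤ C * h := by
      rw [abs_mul, abs_of_nonneg hh, mul_comm]
      exact mul_le_mul_of_nonneg_right (hC x) hh
    exact (norm_exp_mul_I_sub_le (h4.trans hCh)).trans
      (pow_le_pow_left₀ (abs_nonneg _) h4 3)
  have h5 : ‖((1 - h ^ 2 * m / 2 : ℝ) : ℂ) - ((Real.exp (-(h ^ 2 * m) / 2) : ℝ) : ℂ)‖ ≤
      (C * h) ^ 4 := by
    rw [← Complex.ofReal_sub, Complex.norm_real, Real.norm_eq_abs, abs_sub_comm]
    have h6 : h ^ 2 * m ≤ (C * h) ^ 2 := by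
      rw [mul_pow, mul_comm]; exact mul_le_mul_of_nonneg_right hmC (sq_nonneg h)
    have h60 : 0 ≤ h ^ 2 * m := by positivity
    have h7 : (C * h) ^ 2 ≤ 1 := pow_le_one₀ hCh0 hCh
    have h8 : |-(h ^ 2 * m) / 2| ≤ 1 := by
      rw [abs_div, abs_neg, abs_of_nonneg h60, Nat.abs_ofNat]; linarith
    have h9 := Real.abs_exp_sub_one_sub_id_le h8
    have h10 : Real.exp (-(h ^ 2 * m) / 2) - (1 - h ^ 2 * m / 2) =
        Real.exp (-(h ^ 2 * m) / 2) - 1 - -(h ^ 2 * m) / 2 := by ring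
    rw [h10]
    refine h9.trans ?_
    have h11 : (h ^ 2 * m) ^ 2 ≤ ((C * h) ^ 2) ^ 2 := pow_le_pow_left₀ h60 h6 2
    have h12 : ((C * h) ^ 2) ^ 2 = (C * h) ^ 4 := by ring
    nlinarith
  have h13 := norm_sub_le_norm_sub_add_norm_sub
    (∫ x, Complex.exp (((h * Y x : ℝ) : ℂ) * Complex.I)) (((1 - h ^ 2 * m / 2 : ℝ) : ℂ))
    ((Real.exp (-(h ^ 2 * m) / 2) : ℝ) : ℂ)
  linarith

/-- Independence factors the characteristic function. With `h = (2 n + 1)^(-1/2)`, each factor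
differs from its Gaussian counterpart by `O(h³)`, and `2 n + 1 = h⁻²` factors leave `O(h)`. Only the
total variance is prescribed, since the summands need not be identically distributed. -/
theorem tendsto_integral_exp_sum (Y : (n : ℕ) → ZMod (2 * n + 1) → UnitAddCircle → ℝ) (C s : ℝ)
    (hY : ∀ n j, Measurable (Y n j)) (hC : ∀ n j x, |Y n j x| ≤ C)
    (h0 : ∀ n j, ∫ x, Y n j x = 0)
    (hs : ∀ᶠ n : ℕ in atTop, ∑ j, ∫ x, Y n j x ^ 2 = (2 * n + 1) * s) :
    Tendsto (fun n : ℕ => ∫ U : ZMod (2 * n + 1) → UnitAddCircle,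
      Complex.exp ((((√(2 * n + 1))⁻¹ * ∑ j, Y n j (U j) : ℝ) : ℂ) * Complex.I)) atTop
      (𝓝 ((Real.exp (-s / 2) : ℝ) : ℂ)) := by
  have hC0 : 0 ≤ C := (abs_nonneg _).trans (hC 0 0 0)
  have hN : Tendsto (fun n : ℕ => (2 * n + 1 : ℝ)) atTop atTop :=
    tendsto_atTop_add_const_right _ _ (tendsto_natCast_atTop_atTop.const_mul_atTop two_pos)
  have hh : Tendsto (fun n : ℕ => (√(2 * n + 1 : ℝ))⁻¹) atTop (𝓝 0) :=
    tendsto_inv_atTop_zero.comp (Real.tendsto_sqrt_atTop.comp hN)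
  have hbound : Tendsto (fun n : ℕ => C ^ 3 * (√(2 * n + 1 : ℝ))⁻¹ +
      C ^ 4 * (√(2 * n + 1 : ℝ))⁻¹ ^ 2) atTop (𝓝 0) := by
    have := (hh.const_mul (C ^ 3)).add ((hh.pow 2).const_mul (C ^ 4))
    simpa using this
  rw [tendsto_iff_norm_sub_tendsto_zero]
  refine squeeze_zero' (Eventually.of_forall fun n => norm_nonneg _) ?_ hbound
  have hsmall : ∀ᶠ n : ℕ in atTop, C * (√(2 * n + 1 : ℝ))⁻¹ < 1 := by
    have := hh.const_mul C
    rw [mul_zero] at this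
    exact this.eventually (gt_mem_nhds zero_lt_one)
  filter_upwards [hs, hsmall] with n hn hn1
  have hNpos : (0 : ℝ) < 2 * n + 1 := by positivity
  set h := (√(2 * n + 1 : ℝ))⁻¹ with hhdef
  have hhpos : 0 ≤ h := by positivity
  have hh2 : h ^ 2 * (2 * n + 1) = 1 := by
    rw [hhdef, inv_pow, Real.sq_sqrt hNpos.le]; field_simp
  have h1 : ∫ U : ZMod (2 * n + 1) → UnitAddCircle,
      Complex.exp (((h * ∑ j, Y n j (U j) : ℝ) : ℂ) * Complex.I) =
      ∏ j, ∫ x, Complex.exp (((h * Y n j x : ℝ) : ℂ) * Complex.I) := by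
    rw [← integral_fintype_prod_volume_eq_prod]
    congr 1
    funext U
    rw [← Complex.exp_sum, Finset.mul_sum]
    push_cast
    rw [Finset.sum_mul]
  have h2 : ((Real.exp (-s / 2) : ℝ) : ℂ) =
      ∏ j, ((Real.exp (-(h ^ 2 * ∫ x, Y n j x ^ 2) / 2) : ℝ) : ℂ) := by
    rw [← Complex.ofReal_prod, ← Real.exp_sum, ← Finset.sum_div, Finset.sum_neg_distrib,
      ← Finset.mul_sum, hn, ← mul_assoc, hh2, one_mul]
  rw [h1, h2]
  refine (norm_prod_sub_prod_le _ _ _ (fun j _ => ?_) (fun j _ => ?_)).trans ?_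
  · refine (norm_integral_le_of_norm_le_const (C := 1) (ae_of_all _ fun x => ?_)).trans (by simp)
    rw [Complex.norm_exp_ofReal_mul_I]
  · rw [Complex.norm_real, Real.norm_eq_abs, abs_of_pos (Real.exp_pos _), Real.exp_le_one_iff]
    have : 0 ≤ ∫ x, Y n j x ^ 2 := integral_nonneg fun x => sq_nonneg _
    have : 0 ≤ h ^ 2 * ∫ x, Y n j x ^ 2 := by positivity
    linarith
  · refine (Finset.sum_le_sum fun j _ => norm_integral_exp_sub_exp_le (hY n j) (hC n j) (h0 n j)
      hhpos hn1.le).trans (le_of_eq ?_)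
    simp only [Finset.sum_const, Finset.card_univ, ZMod.card, nsmul_eq_mul]
    push_cast
    have e1 : (2 * (n : ℝ) + 1) * ((C * h) ^ 3 + (C * h) ^ 4) =
      (h ^ 2 * (2 * n + 1)) * (C ^ 3 * h + C ^ 4 * h ^ 2) := by ring
    rw [e1, hh2, one_mul]

/-! ### Quadratic forms of Gaussian vectors -/

/-- The square avoids a branch of the complex square root, and suffices because real and imaginary
parts of each sum carry the same coefficient. -/
lemma sq_integral_exp_mul_sq_gaussianReal (b : ℝ) :
    (∫ x, Complex.exp (((b * x ^ 2 : ℝ) : ℂ) * Complex.I) ∂(gaussianReal 0 1)) ^ 2 =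
      (1 - 2 * b * Complex.I)⁻¹ := by
  rw [integral_gaussianReal_eq_integral_smul one_ne_zero]
  have h1 : ∀ x : ℝ, gaussianPDFReal 0 1 x • Complex.exp (((b * x ^ 2 : ℝ) : ℂ) * Complex.I) =
      (((√(2 * Real.pi))⁻¹ : ℝ) : ℂ) * Complex.exp (-(1 / 2 - b * Complex.I) * (x : ℂ) ^ 2) := by
    intro x
    rw [gaussianPDFReal, Complex.real_smul, Complex.ofReal_mul, Complex.ofReal_exp, mul_assoc,
      ← Complex.exp_add]
    simp only [NNReal.coe_one, mul_one, sub_zero]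
    congr 2
    push_cast; ring
  simp_rw [h1]
  have hre : 0 < (1 / 2 - b * Complex.I : ℂ).re := by simp
  rw [integral_const_mul, integral_gaussian_complex hre, mul_pow, ← Complex.ofReal_pow, inv_pow,
    Real.sq_sqrt (by positivity), ← Complex.cpow_nat_mul]
  have hne : (1 / 2 - b * Complex.I : ℂ) ≠ 0 := fun h => by rw [h] at hre; simp at hre
  have hne' : (1 - 2 * b * Complex.I : ℂ) ≠ 0 := fun h => hne (by linear_combination h / 2)
  have hpi : (Real.pi : ℂ) ≠ 0 := by exact_mod_cast Real.pi_ne_zero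
  norm_num
  field_simp

/-! ### The trigonometric sums behind `writheApprox` -/

/-- Indices of the trigonometric sums: the frequencies in the two variables, the sign of the second
frequency, and the choice between real and imaginary part. -/
abbrev TrigIndex (T : ℕ) : Type := (Fin T × Fin T × Bool) × Bool

/-- The two-variable character with frequencies `2 k + 1` and `± (l + 1)`. -/
noncomputable def trigChar (n : ℕ) {T : ℕ} (a : Fin T × Fin T × Bool) (j : ZMod (2 * n + 1))
    (x : UnitAddCircle) : ℂ :=
  oddChar n a.1 j *
    fourier (T := 1) (if a.2.2 then ((a.2.1 : ℕ) + 1 : ℤ) else -((a.2.1 : ℕ) + 1 : ℤ)) x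

/-- The real or imaginary part of a complex number. -/
noncomputable def complexPart (r : Bool) (z : ℂ) : ℝ := if r then z.re else z.im

lemma continuous_complexPart (r : Bool) : Continuous (complexPart r) := by
  cases r
  · exact Complex.continuous_im
  · exact Complex.continuous_re

lemma abs_complexPart_le (r : Bool) (z : ℂ) : |complexPart r z| ≤ ‖z‖ := by
  cases r
  · exact Complex.abs_im_le_norm z
  · exact Complex.abs_re_le_norm z

lemma norm_trigChar (n : ℕ) {T : ℕ} (a : Fin T × Fin T × Bool) (j : ZMod (2 * n + 1))
    (x : UnitAddCircle) : ‖trigChar n a j x‖ = 1 := by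
  rw [trigChar, norm_mul, norm_oddChar, one_mul]
  exact Circle.norm_coe _

lemma continuous_trigChar (n : ℕ) {T : ℕ} (a : Fin T × Fin T × Bool) (j : ZMod (2 * n + 1)) :
    Continuous (trigChar n a j) :=
  continuous_const.mul (fourier (T := 1) _).continuous

lemma integrable_of_continuous_unitAddCircle {f : UnitAddCircle → ℂ} (hf : Continuous f) :
    Integrable f :=
  hf.integrable_of_hasCompactSupport (HasCompactSupport.of_compactSpace f)

lemma integral_trigChar (n : ℕ) {T : ℕ} (a : Fin T × Fin T × Bool) (j : ZMod (2 * n + 1)) :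
    ∫ x, trigChar n a j x = 0 := by
  simp only [trigChar]
  rw [integral_const_mul, integral_fourier, if_neg, mul_zero]
  split_ifs <;> omega

/-- The position characters alone force the vanishing, whatever the frequencies in `x`: two odd
frequencies never cancel modulo `2 n + 1` in this range. -/
lemma sum_integral_trigChar_mul {n T : ℕ} (h : 2 * T ≤ n) (a b : Fin T × Fin T × Bool) :
    ∑ j, ∫ x, trigChar n a j x * trigChar n b j x = 0 := by
  have h1 : ∀ j, ∫ x, trigChar n a j x * trigChar n b j x =
      (oddChar n a.1 j * oddChar n b.1 j) * ∫ x, fourier (T := 1)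
        (if a.2.2 then ((a.2.1 : ℕ) + 1 : ℤ) else -((a.2.1 : ℕ) + 1 : ℤ)) x *
        fourier (T := 1) (if b.2.2 then ((b.2.1 : ℕ) + 1 : ℤ) else -((b.2.1 : ℕ) + 1 : ℤ)) x :=
    fun j => by
      rw [← integral_const_mul]
      refine integral_congr_ae (ae_of_all _ fun x => ?_)
      simp only [trigChar]; ring
  simp_rw [h1]
  rw [← Finset.sum_mul, sum_oddChar_mul (by omega), zero_mul]

lemma sum_integral_trigChar_mul_conj {n T : ℕ} (h : 2 * T ≤ n) (a b : Fin T × Fin T × Bool) :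
    ∑ j, ∫ x, trigChar n a j x * (starRingEnd ℂ) (trigChar n b j x) =
      if a = b then (2 * n + 1 : ℂ) else 0 := by
  have h1 : ∀ j, ∫ x, trigChar n a j x * (starRingEnd ℂ) (trigChar n b j x) =
      (oddChar n a.1 j * (starRingEnd ℂ) (oddChar n b.1 j)) * ∫ x, fourier (T := 1)
        ((if a.2.2 then ((a.2.1 : ℕ) + 1 : ℤ) else -((a.2.1 : ℕ) + 1 : ℤ)) -
        (if b.2.2 then ((b.2.1 : ℕ) + 1 : ℤ) else -((b.2.1 : ℕ) + 1 : ℤ))) x :=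
    fun j => by
      rw [← integral_const_mul]
      refine integral_congr_ae (ae_of_all _ fun x => ?_)
      simp only [trigChar]
      rw [sub_eq_add_neg, fourier_add, fourier_neg, map_mul]
      ring
  simp_rw [h1]
  rw [← Finset.sum_mul, sum_oddChar_mul_conj (by omega) (by omega), integral_fourier]
  obtain ⟨k, l, e⟩ := a
  obtain ⟨k', l', e'⟩ := b
  by_cases hk : k = k'
  · subst hk
    simp only [if_true, Prod.mk.injEq, true_and]
    by_cases hl : l = l' ∧ e = e'
    · obtain ⟨rfl, rfl⟩ := hl
      simp
    · rw [if_neg hl, if_neg, mul_zero]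
      intro h'
      apply hl
      cases e <;> cases e' <;> simp at h' ⊢ <;> omega
  · have hk' : (k : ℕ) ≠ k' := fun h' => hk (Fin.ext h')
    simp [hk, hk']

/-- The real trigonometric functions, normalized to have mean square `1`. -/
noncomputable def trigFun (n : ℕ) {T : ℕ} (a : TrigIndex T) (j : ZMod (2 * n + 1))
    (x : UnitAddCircle) : ℝ :=
  √2 * complexPart a.2 (trigChar n a.1 j x)

lemma continuous_trigFun (n : ℕ) {T : ℕ} (a : TrigIndex T) (j : ZMod (2 * n + 1)) :
    Continuous (trigFun n a j) :=
  continuous_const.mul ((continuous_complexPart _).comp (continuous_trigChar n a.1 j))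

lemma abs_trigFun_le (n : ℕ) {T : ℕ} (a : TrigIndex T) (j : ZMod (2 * n + 1))
    (x : UnitAddCircle) : |trigFun n a j x| ≤ √2 := by
  rw [trigFun, abs_mul, abs_of_nonneg (Real.sqrt_nonneg 2)]
  refine mul_le_of_le_one_right (Real.sqrt_nonneg 2) ?_
  exact (abs_complexPart_le _ _).trans (norm_trigChar n a.1 j x).le

lemma integral_complexPart (r : Bool) {f : UnitAddCircle → ℂ} (hf : Continuous f) :
    ∫ x, complexPart r (f x) = complexPart r (∫ x, f x) := by
  have hi := integrable_of_continuous_unitAddCircle hf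
  cases r
  · exact Complex.imCLM.integral_comp_comm hi
  · exact Complex.reCLM.integral_comp_comm hi

lemma integral_trigFun (n : ℕ) {T : ℕ} (a : TrigIndex T) (j : ZMod (2 * n + 1)) :
    ∫ x, trigFun n a j x = 0 := by
  simp only [trigFun]
  rw [integral_const_mul, integral_complexPart _ (continuous_trigChar n a.1 j), integral_trigChar]
  simp [complexPart]

/-- Product-to-sum formulas in one statement: parts of equal kind give a real part, mixed kinds an
imaginary part, so covariances reduce to integrals of `z * conj w` and `z * w`. -/
lemma complexPart_mul_complexPart (r s : Bool) (z w : ℂ) :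
    complexPart r z * complexPart s w = complexPart (r == s)
      ((1 / 2 : ℂ) * ((if r ∧ ¬ s then -1 else 1) * (z * (starRingEnd ℂ) w) +
        (if r ∨ s then 1 else -1) * (z * w))) := by
  cases r <;> cases s <;> simp [complexPart] <;> ring

lemma sum_integral_trigFun_mul {n T : ℕ} (h : 2 * T ≤ n) (a b : TrigIndex T) :
    ∑ j, ∫ x, trigFun n a j x * trigFun n b j x = if a = b then (2 * n + 1 : ℝ) else 0 := by
  obtain ⟨a, r⟩ := a
  obtain ⟨b, s⟩ := b
  have h1 : ∀ j, ∫ x, trigFun n (a, r) j x * trigFun n (b, s) j x =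
      2 * complexPart (r == s) ((1 / 2 : ℂ) * ((if r ∧ ¬ s then -1 else 1) *
        (∫ x, trigChar n a j x * (starRingEnd ℂ) (trigChar n b j x)) +
        (if r ∨ s then 1 else -1) * ∫ x, trigChar n a j x * trigChar n b j x)) := fun j => by
    have c1 := continuous_trigChar n a j
    have c2 := continuous_trigChar n b j
    have c3 : Continuous fun x => trigChar n a j x * (starRingEnd ℂ) (trigChar n b j x) :=
      c1.mul (Complex.continuous_conj.comp c2)
    have c4 : Continuous fun x => trigChar n a j x * trigChar n b j x := c1.mul c2
    rw [← integral_const_mul, ← integral_const_mul, ← integral_add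
      ((integrable_of_continuous_unitAddCircle c3).const_mul _)
      ((integrable_of_continuous_unitAddCircle c4).const_mul _), ← integral_const_mul,
      ← integral_complexPart _ (by fun_prop), ← integral_const_mul]
    refine integral_congr_ae (ae_of_all _ fun x => ?_)
    simp only [trigFun]
    rw [← complexPart_mul_complexPart]
    have h2 : √2 * √2 = (2 : ℝ) := Real.mul_self_sqrt (by norm_num)
    linear_combination complexPart r (trigChar n a j x) * complexPart s (trigChar n b j x) * h2
  have h2 : ∀ (r : Bool) (f : ZMod (2 * n + 1) → ℂ), ∑ j, complexPart r (f j) =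
      complexPart r (∑ j, f j) := fun r f => by cases r <;> simp [complexPart]
  simp_rw [h1]
  rw [← Finset.mul_sum, h2, ← Finset.mul_sum, Finset.sum_add_distrib, ← Finset.mul_sum,
    ← Finset.mul_sum, sum_integral_trigChar_mul h, sum_integral_trigChar_mul_conj h]
  by_cases hab : a = b
  · subst hab
    cases r <;> cases s <;> simp [complexPart]
  · simp [hab, complexPart]

/-- The vector of normalized trigonometric sums. -/
noncomputable def trigVector (n T : ℕ) (U : ZMod (2 * n + 1) → UnitAddCircle) :
    EuclideanSpace ℝ (TrigIndex T) :=
  WithLp.toLp 2 fun a => (√(2 * n + 1))⁻¹ * ∑ j, trigFun n a j (U j)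

lemma continuous_trigVector (n T : ℕ) : Continuous (trigVector n T) := by
  refine (PiLp.continuous_toLp 2 _).comp (continuous_pi fun a => ?_)
  exact continuous_const.mul (continuous_finsetSum _ fun j _ =>
    (continuous_trigFun n a j).comp (continuous_apply j))

/-- The law of `trigVector`. -/
noncomputable def trigLaw (T n : ℕ) : ProbabilityMeasure (EuclideanSpace ℝ (TrigIndex T)) :=
  ⟨(volume : Measure (ZMod (2 * n + 1) → UnitAddCircle)).map (trigVector n T),
    Measure.isProbabilityMeasure_map (continuous_trigVector n T).measurable.aemeasurable⟩

lemma sum_integral_sq_linear {n T : ℕ} (h : 2 * T ≤ n) (t : TrigIndex T → ℝ) :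
    ∑ j, ∫ x, (∑ a, t a * trigFun n a j x) ^ 2 = (2 * n + 1) * ∑ a, t a ^ 2 := by
  have h1 : ∀ j x, (∑ a, t a * trigFun n a j x) ^ 2 =
      ∑ a, ∑ b, t a * t b * (trigFun n a j x * trigFun n b j x) := fun j x => by
    rw [sq, Finset.sum_mul_sum]
    exact Finset.sum_congr rfl fun a _ => Finset.sum_congr rfl fun b _ => by ring
  have hi : ∀ j a b, Integrable fun x => t a * t b * (trigFun n a j x * trigFun n b j x) :=
    fun j a b => (integrable_of_measurable_of_abs_le (C := √2 * √2)
      ((continuous_trigFun n a j).mul (continuous_trigFun n b j)).measurable fun x => by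
        rw [Pi.mul_apply, abs_mul]
        exact mul_le_mul (abs_trigFun_le n a j x) (abs_trigFun_le n b j x) (abs_nonneg _)
          (Real.sqrt_nonneg 2)).const_mul _
  have h2 : ∀ j, ∫ x, (∑ a, t a * trigFun n a j x) ^ 2 =
      ∑ a, ∑ b, t a * t b * ∫ x, trigFun n a j x * trigFun n b j x := fun j => by
    simp_rw [h1]
    rw [integral_finsetSum _ fun a _ => integrable_finsetSum _ fun b _ => hi j a b]
    refine Finset.sum_congr rfl fun a _ => ?_
    rw [integral_finsetSum _ fun b _ => hi j a b]
    simp_rw [integral_const_mul]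
  simp_rw [h2]
  rw [Finset.sum_comm, Finset.mul_sum]
  refine Finset.sum_congr rfl fun a _ => ?_
  rw [Finset.sum_comm, Finset.sum_eq_single a]
  · rw [← Finset.mul_sum, sum_integral_trigFun_mul h, if_pos rfl]; ring
  · intro b _ hb
    rw [← Finset.mul_sum, sum_integral_trigFun_mul h, if_neg (Ne.symm hb), mul_zero]
  · intro h'; exact absurd (Finset.mem_univ a) h'

/-- A linear functional of the vector is a sum of independent bounded centered terms, whose variance
is exactly `‖t‖ ^ 2` once `2 * T ≤ n`; convergence of characteristic functions follows as in
Cramér–Wold. -/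
theorem tendsto_trigLaw (T : ℕ) : Tendsto (trigLaw T) atTop
    (𝓝 ⟨stdGaussian (EuclideanSpace ℝ (TrigIndex T)), inferInstance⟩) := by
  refine ProbabilityMeasure.tendsto_of_tendsto_charFun fun t => ?_
  rw [ProbabilityMeasure.coe_mk, charFun_stdGaussian]
  have hm : ∀ n j, Continuous fun x => ∑ a, t a * trigFun n a j x := fun n j =>
    continuous_finsetSum _ fun a _ => continuous_const.mul (continuous_trigFun n a j)
  have h := tendsto_integral_exp_sum (fun n j x => ∑ a, t a * trigFun n a j x)
    (∑ a, |t a| * √2) (∑ a, t a ^ 2) (fun n j => (hm n j).measurable)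
    (fun n j x => (Finset.abs_sum_le_sum_abs _ _).trans (Finset.sum_le_sum fun a _ => by
      rw [abs_mul]
      exact mul_le_mul_of_nonneg_left (abs_trigFun_le n a j x) (abs_nonneg _)))
    (fun n j => by
      rw [integral_finsetSum _ fun a _ => (integrable_of_measurable_of_abs_le
        (continuous_trigFun n a j).measurable (abs_trigFun_le n a j)).const_mul _]
      simp [integral_const_mul, integral_trigFun])
    (by filter_upwards [eventually_ge_atTop (2 * T)] with n hn
        exact sum_integral_sq_linear hn _)
  have hnorm : ‖t‖ ^ 2 = ∑ a, t a ^ 2 := by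
    rw [EuclideanSpace.norm_sq_eq]; simp
  have e1 : Complex.exp (-(‖t‖ : ℂ) ^ 2 / 2) = ((Real.exp (-(∑ a, t a ^ 2) / 2) : ℝ) : ℂ) := by
    rw [← hnorm]; push_cast; rfl
  rw [e1]
  refine h.congr fun n => ?_
  rw [trigLaw, ProbabilityMeasure.coe_mk, charFun_apply, integral_map
    (continuous_trigVector n T).measurable.aemeasurable (by fun_prop)]
  refine integral_congr_ae (ae_of_all _ fun U => ?_)
  simp only
  congr 3
  rw [PiLp.inner_apply]
  simp only [trigVector, RCLike.inner_apply, conj_trivial, Finset.mul_sum]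
  rw [Finset.sum_comm]
  refine Finset.sum_congr rfl fun a _ => ?_
  exact Finset.sum_congr rfl fun j _ => by ring

/-- The coefficients of the limiting quadratic form. -/
noncomputable def quadCoeff {T : ℕ} (a : TrigIndex T) : ℝ :=
  (if a.1.2.2 then -1 else 1) * laplaceScale (a.1.1, a.1.2.1) / 2

/-! ### Diagonalization of the approximating quadratic form. -/

lemma sum_sum_re_mul_conj {ι : Type*} [Fintype ι] (z : ι → ℂ) :
    ∑ i, ∑ j, (z j * (starRingEnd ℂ) (z i)).re = (∑ j, (z j).re) ^ 2 + (∑ j, (z j).im) ^ 2 := by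
  simp only [Complex.mul_re, Complex.conj_re, Complex.conj_im, mul_neg, sub_neg_eq_add,
    Finset.sum_add_distrib]
  rw [sq, sq, Finset.sum_mul_sum, Finset.sum_mul_sum]
  congr 1 <;> exact Finset.sum_comm

lemma circleSin_sub (l : ℕ) (x y : UnitAddCircle) : circleSin l (x - y) =
    (fourier (T := 1) (l : ℤ) x * (starRingEnd ℂ) (fourier (T := 1) (l : ℤ) y)).im := by
  rw [circleSin, ← fourier_neg]
  congr 1
  rw [fourier_apply, fourier_apply, fourier_apply, smul_sub, sub_eq_add_neg, AddCircle.toCircle_add,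
    neg_smul, Circle.coe_mul]

lemma circleSin_neg (l : ℕ) (x : UnitAddCircle) : circleSin l (-x) = -circleSin l x := by
  have h := circleSin_sub l 0 x
  rw [zero_sub, fourier_eval_zero, one_mul, Complex.conj_im] at h
  exact h

lemma sawtoothPartial_neg (T : ℕ) (x : UnitAddCircle) :
    sawtoothPartial T (-x) = -sawtoothPartial T x := by
  simp only [sawtoothPartial, circleSin_neg, mul_neg, Finset.sum_neg_distrib]

/-- The product of two odd kernels is symmetric in `i, j`, so the half sum over `d` is half the full
double sum. A product of sines is half the difference of two cosines of phase differences, and each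
such cosine sums to the squared modulus of a trigonometric sum. -/
lemma writheApprox_eq (n T : ℕ) (U : ZMod (2 * n + 1) → UnitAddCircle) :
    writheApprox n T U = ∑ a, quadCoeff a * (trigVector n T U a) ^ 2 := by
  have hN : (0 : ℝ) < 2 * n + 1 := by positivity
  have h1 := sum_sum_zmod_eq n
    (fun i j => squarePartial n T (j - i) * sawtoothPartial T (U j - U i))
    (fun i j => by
      rw [← neg_sub j i, ← neg_sub (U j) (U i), squarePartial_neg, sawtoothPartial_neg]; ring)
    (fun i => by simp [squarePartial, oddChar_zero])
  simp only [add_sub_cancel_left] at h1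
  have h2 : writheApprox n T U = (1 / (2 * n + 1)) *
      ∑ i, ∑ j, squarePartial n T (j - i) * sawtoothPartial T (U j - U i) := by
    rw [h1, writheApprox]; ring
  -- one pair of frequencies
  have h3 : ∀ k l : Fin T, ∑ i, ∑ j, (oddChar n k (j - i)).im * circleSin (l + 1) (U j - U i) =
      (1 / 2) * (((∑ j, (trigChar n (k, l, false) j (U j)).re) ^ 2 +
        (∑ j, (trigChar n (k, l, false) j (U j)).im) ^ 2) -
        ((∑ j, (trigChar n (k, l, true) j (U j)).re) ^ 2 +
        (∑ j, (trigChar n (k, l, true) j (U j)).im) ^ 2)) := fun k l => by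
    rw [← sum_sum_re_mul_conj, ← sum_sum_re_mul_conj, ← Finset.sum_sub_distrib, Finset.mul_sum]
    refine Finset.sum_congr rfl fun i _ => ?_
    rw [← Finset.sum_sub_distrib, Finset.mul_sum]
    refine Finset.sum_congr rfl fun j _ => ?_
    rw [oddChar_sub, circleSin_sub]
    simp only [trigChar, if_true, Bool.false_eq_true, if_false, fourier_neg, Nat.cast_add,
      Nat.cast_one, Complex.mul_re, Complex.mul_im, Complex.conj_re, Complex.conj_im]
    ring
  have h4 : ∑ i, ∑ j, squarePartial n T (j - i) * sawtoothPartial T (U j - U i) =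
      -- The weight is the product of the Fourier coefficients `4 / (π (2 k + 1))` and `2 / (π (l +
      -- 1))`.
      ∑ k : Fin T, ∑ l : Fin T, 2 * laplaceScale (k, l) *
        ∑ i, ∑ j, (oddChar n k (j - i)).im * circleSin (l + 1) (U j - U i) := by
    simp only [squarePartial, sawtoothPartial, Finset.sum_range, Finset.sum_mul_sum]
    rw [Finset.sum_congr rfl fun i _ => Finset.sum_comm, Finset.sum_comm]
    refine Finset.sum_congr rfl fun k _ => ?_
    rw [Finset.sum_congr rfl fun i _ => Finset.sum_comm, Finset.sum_comm]
    refine Finset.sum_congr rfl fun l _ => ?_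
    rw [Finset.mul_sum]
    refine Finset.sum_congr rfl fun i _ => ?_
    rw [Finset.mul_sum]
    refine Finset.sum_congr rfl fun j _ => ?_
    simp only [laplaceScale]
    field_simp
  rw [h2, h4, Finset.mul_sum]
  simp only [Fintype.sum_prod_type, Fintype.sum_bool]
  refine Finset.sum_congr rfl fun k _ => ?_
  rw [Finset.mul_sum]
  refine Finset.sum_congr rfl fun l _ => ?_
  rw [h3]
  have hsq : ((√(2 * n + 1 : ℝ))⁻¹) ^ 2 = 1 / (2 * n + 1) := by
    rw [inv_pow, Real.sq_sqrt hN.le, one_div]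
  have h5 : ∀ (e r : Bool), (trigVector n T U ((k, l, e), r)) ^ 2 =
      2 / (2 * n + 1) * (∑ j, complexPart r (trigChar n (k, l, e) j (U j))) ^ 2 := fun e r => by
    simp only [trigVector, trigFun]
    rw [← Finset.mul_sum, mul_pow, mul_pow, hsq, Real.sq_sqrt (by norm_num)]
    ring
  simp only [h5, quadCoeff, complexPart, if_true, Bool.false_eq_true, if_false]
  ring

/-- The characteristic function of the limiting quadratic form. -/
lemma tendsto_integral_exp_writheApprox (T : ℕ) (t : ℝ) :
    Tendsto (fun n : ℕ => ∫ U : ZMod (2 * n + 1) → UnitAddCircle,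
      Complex.exp (((t * writheApprox n T U : ℝ) : ℂ) * Complex.I)) atTop
      (𝓝 ((∏ k ∈ Finset.range T, ∏ l ∈ Finset.range T,
        (1 + laplaceScale (k, l) ^ 2 * t ^ 2)⁻¹ : ℝ) : ℂ)) := by
  set f : EuclideanSpace ℝ (TrigIndex T) → ℂ := fun y =>
    Complex.exp (((t * ∑ a, quadCoeff a * y a ^ 2 : ℝ) : ℂ) * Complex.I) with hf
  have hfc : Continuous f := by fun_prop
  let g : BoundedContinuousFunction (EuclideanSpace ℝ (TrigIndex T)) ℂ :=
    BoundedContinuousFunction.ofNormedAddCommGroup f hfc 1 fun y => by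
      rw [hf, Complex.norm_exp_ofReal_mul_I]
  have h1 := (ProbabilityMeasure.tendsto_iff_forall_integral_rclike_tendsto ℂ).1
    (tendsto_trigLaw T) g
  have h2 : ∀ n : ℕ, ∫ y, g y ∂(trigLaw T n : Measure (EuclideanSpace ℝ (TrigIndex T))) =
      ∫ U : ZMod (2 * n + 1) → UnitAddCircle,
        Complex.exp (((t * writheApprox n T U : ℝ) : ℂ) * Complex.I) := fun n => by
    rw [trigLaw, ProbabilityMeasure.coe_mk, integral_map
      (continuous_trigVector n T).measurable.aemeasurable g.continuous.aestronglyMeasurable]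
    refine integral_congr_ae (ae_of_all _ fun U => ?_)
    simp only [writheApprox_eq]
    rfl
  simp_rw [h2] at h1
  convert h1 using 2
  rw [ProbabilityMeasure.coe_mk, ← map_pi_eq_stdGaussian, integral_map
    (by fun_prop) g.continuous.aestronglyMeasurable]
  have h3 : ∀ y : TrigIndex T → ℝ, g (WithLp.toLp 2 y) =
      ∏ a, Complex.exp (((t * quadCoeff a * y a ^ 2 : ℝ) : ℂ) * Complex.I) := fun y => by
    rw [← Complex.exp_sum]
    change Complex.exp _ = _
    congr 1
    simp only [Finset.mul_sum]
    push_cast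
    rw [Finset.sum_mul]
    exact Finset.sum_congr rfl fun a _ => by ring
  simp_rw [h3]
  rw [integral_fintype_prod_eq_prod (μ := fun _ : TrigIndex T => gaussianReal 0 1)
    (fun a x => Complex.exp (((t * quadCoeff a * x ^ 2 : ℝ) : ℂ) * Complex.I))]
  simp only [Fintype.prod_prod_type, Finset.prod_range, Fintype.prod_bool]
  simp only [Complex.ofReal_prod]
  refine Finset.prod_congr rfl fun k _ => Finset.prod_congr rfl fun l _ => ?_
  -- For each `(k, l)` with scale `c` the two signs give `((1 + i c t) (1 - i c t))⁻¹`, the Laplace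
  -- factor.
  simp only [quadCoeff, if_true, Bool.false_eq_true, if_false, ← sq,
    sq_integral_exp_mul_sq_gaussianReal]
  rw [← mul_inv, Complex.ofReal_inv]
  congr 1
  push_cast
  linear_combination ((laplaceScale (k, l) : ℂ) ^ 2 * (t : ℂ) ^ 2) * Complex.I_sq

/-! ### Convergence of the normalized writhe -/

lemma integral_abs_le_sqrt_integral_sq {α : Type*} [MeasurableSpace α] {μ : Measure α}
    [IsProbabilityMeasure μ] {Z : α → ℝ} {C : ℝ} (hZ : Measurable Z) (hC : ∀ x, |Z x| ≤ C) :
    ∫ x, |Z x| ∂μ ≤ √(∫ x, Z x ^ 2 ∂μ) := by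
  refine Real.le_sqrt_of_sq_le ?_
  set m := ∫ x, |Z x| ∂μ with hm
  have i1 : Integrable (fun x => |Z x|) μ :=
    (integrable_of_measurable_of_abs_le hZ hC).abs
  have i2 : Integrable (fun x => Z x ^ 2) μ :=
    integrable_of_measurable_of_abs_le (C := C ^ 2) (hZ.pow_const 2) fun x => by
      rw [abs_pow]; exact pow_le_pow_left₀ (abs_nonneg _) (hC x) 2
  have h1 : 0 ≤ ∫ x, (|Z x| - m) ^ 2 ∂μ := integral_nonneg fun x => sq_nonneg _
  have h2 : ∀ x, (|Z x| - m) ^ 2 = Z x ^ 2 - 2 * m * |Z x| + m ^ 2 := fun x => by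
    rw [sub_sq, sq_abs]; ring
  have i3 : Integrable (fun x => Z x ^ 2 - 2 * m * |Z x|) μ := i2.sub (i1.const_mul _)
  simp_rw [h2] at h1
  rw [integral_add i3 (integrable_const _), integral_sub i2 (i1.const_mul _), integral_const_mul,
    ← hm] at h1
  simp only [integral_const, probReal_univ, one_smul] at h1
  linarith

/-- From `|exp (i a) - 1| ≤ |a|` and Cauchy–Schwarz; this turns mean square approximation into
closeness of characteristic functions. -/
lemma norm_integral_exp_sub_integral_exp_le {α : Type*} [MeasurableSpace α] {μ : Measure α}
    [IsProbabilityMeasure μ] {X Y : α → ℝ} {C D : ℝ} (hX : Measurable X) (hY : Measurable Y)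
    (hC : ∀ x, |X x| ≤ C) (hD : ∀ x, |Y x| ≤ D) (t : ℝ) :
    ‖(∫ x, Complex.exp (((t * X x : ℝ) : ℂ) * Complex.I) ∂μ) -
      ∫ x, Complex.exp (((t * Y x : ℝ) : ℂ) * Complex.I) ∂μ‖ ≤
      |t| * √(∫ x, (X x - Y x) ^ 2 ∂μ) := by
  have hi : ∀ {X : α → ℝ}, Measurable X →
      Integrable (fun x => Complex.exp (((t * X x : ℝ) : ℂ) * Complex.I)) μ := fun hX =>
    Integrable.of_bound (by fun_prop) 1 (ae_of_all _ fun x => by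
      rw [Complex.norm_exp_ofReal_mul_I])
  have hZ : ∀ x, |X x - Y x| ≤ C + D := fun x =>
    (abs_sub _ _).trans (add_le_add (hC x) (hD x))
  rw [← integral_sub (hi hX) (hi hY)]
  refine (norm_integral_le_integral_norm _).trans ?_
  refine le_trans ?_ (mul_le_mul_of_nonneg_left
    (integral_abs_le_sqrt_integral_sq (μ := μ) (hX.sub hY) hZ) (abs_nonneg t))
  rw [← integral_const_mul]
  refine integral_mono ((hi hX).sub (hi hY)).norm
    ((integrable_of_measurable_of_abs_le (hX.sub hY) hZ).abs.const_mul _) fun x => ?_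
  have h1 : Complex.exp (((t * X x : ℝ) : ℂ) * Complex.I) -
      Complex.exp (((t * Y x : ℝ) : ℂ) * Complex.I) =
      Complex.exp (((t * Y x : ℝ) : ℂ) * Complex.I) *
        (Complex.exp (Complex.I * ((t * (X x - Y x) : ℝ) : ℂ)) - 1) := by
    rw [mul_sub, ← Complex.exp_add, mul_one]
    congr 2
    push_cast; ring
  simp only
  rw [h1, norm_mul, Complex.norm_exp_ofReal_mul_I, one_mul, ← abs_mul]
  exact Real.norm_exp_I_mul_ofReal_sub_one_le

/-- The squares `range T ×ˢ range T` exhaust `ℕ × ℕ`, and unconditional summability of the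
logarithms makes the order irrelevant. -/
lemma tendsto_prod_laplaceScale (t : ℝ) :
    Tendsto (fun T : ℕ => ∏ k ∈ Finset.range T, ∏ l ∈ Finset.range T,
        (1 + laplaceScale (k, l) ^ 2 * t ^ 2)⁻¹) atTop
      (𝓝 (Real.exp (-∑' i, Real.log (1 + laplaceScaleSeq i ^ 2 * t ^ 2)))) := by
  have h1 : HasSum (fun p : ℕ × ℕ => Real.log (1 + laplaceScale p ^ 2 * t ^ 2))
      (∑' i, Real.log (1 + laplaceScaleSeq i ^ 2 * t ^ 2)) :=
    (Nat.pairEquiv.symm.hasSum_iff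
      (f := fun p => Real.log (1 + laplaceScale p ^ 2 * t ^ 2))).1
      (summable_log_one_add_sq_mul summable_laplaceScaleSeq_sq t).hasSum
  have h2 : Tendsto (fun T : ℕ => Finset.range T ×ˢ Finset.range T) atTop atTop := by
    have h := tendsto_finset_range.prodMk tendsto_finset_range
    rw [prod_atTop_atTop_eq] at h
    exact tendsto_finsetProd_atTop.comp h
  have h3 : Tendsto (fun s : Finset (ℕ × ℕ) => ∑ p ∈ s, Real.log (1 + laplaceScale p ^ 2 * t ^ 2))
      atTop (𝓝 (∑' i, Real.log (1 + laplaceScaleSeq i ^ 2 * t ^ 2))) := by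
    simpa [HasSum] using h1
  refine ((Real.continuous_exp.tendsto _).comp (h3.comp h2).neg).congr fun T => ?_
  rw [Function.comp_apply, Function.comp_apply, ← Finset.sum_neg_distrib, Real.exp_sum,
    Finset.prod_product]
  refine Finset.prod_congr rfl fun k _ => Finset.prod_congr rfl fun l _ => ?_
  rw [← Real.log_inv, Real.exp_log (by positivity)]

lemma continuous_writheApprox (n T : ℕ) : Continuous (writheApprox n T) := by
  have h : writheApprox n T = fun U => ∑ a, quadCoeff a * (trigVector n T U a) ^ 2 :=
    funext (writheApprox_eq n T)
  rw [h]
  have hc := continuous_trigVector n T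
  exact continuous_finsetSum _ fun a _ =>
    continuous_const.mul (((EuclideanSpace.proj (𝕜 := ℝ) a).continuous.comp hc).pow 2)

lemma exists_abs_writheApprox_le (n T : ℕ) : ∃ C, ∀ U, |writheApprox n T U| ≤ C := by
  obtain ⟨C, hC⟩ := isCompact_univ.exists_bound_of_continuousOn
    (continuous_writheApprox n T).continuousOn
  exact ⟨C, fun U => hC U (Set.mem_univ U)⟩

lemma exists_abs_writhe_le (n : ℕ) : ∃ C, ∀ U : ZMod (2 * n + 1) → UnitAddCircle,
    |(writhe n (circleLift ∘ U) : ℝ) / n| ≤ C := by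
  refine ⟨(∑ _i : ZMod (2 * n + 1), ∑ _d ∈ Finset.Icc 1 n, (1 : ℝ)) / n, fun U => ?_⟩
  rw [abs_div, Nat.abs_cast, writhe_circleLift_eq]
  refine div_le_div_of_nonneg_right ?_ n.cast_nonneg
  refine (Finset.abs_sum_le_sum_abs _ _).trans (Finset.sum_le_sum fun i _ => ?_)
  exact (Finset.abs_sum_le_sum_abs _ _).trans (Finset.sum_le_sum fun d _ => abs_sawtooth_le _)

theorem tendsto_charFun_normalizedWritheLaw (t : ℝ) :
    Tendsto (fun n => charFun (normalizedWritheLaw n : Measure ℝ) t) atTop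
      (𝓝 ((Real.exp (-∑' i, Real.log (1 + laplaceScaleSeq i ^ 2 * t ^ 2)) : ℝ) : ℂ)) := by
  have hprod := (Complex.continuous_ofReal.tendsto _).comp (tendsto_prod_laplaceScale t)
  have herr : Tendsto (fun T => |t| * √(approxError T)) atTop (𝓝 0) := by
    have := ((Real.continuous_sqrt.tendsto 0).comp tendsto_approxError).const_mul |t|
    simpa using this
  rw [Metric.tendsto_nhds]
  intro ε hε
  have hε3 : 0 < ε / 3 := by positivity
  -- The truncation `T` is fixed before `n`: the central limit theorem is available only for a fixed
  -- finite set of frequencies.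
  obtain ⟨T, hT1, hT2⟩ := ((herr.eventually (gt_mem_nhds hε3)).and
    (Metric.tendsto_nhds.1 hprod (ε / 3) hε3)).exists
  have h1 : Tendsto (fun n : ℕ => |t| * √(∫ U : ZMod (2 * n + 1) → UnitAddCircle,
      (writhe n (circleLift ∘ U) / n - writheApprox n T U) ^ 2)) atTop
      (𝓝 (|t| * √(approxError T))) :=
    ((Real.continuous_sqrt.tendsto _).comp
      (tendsto_integral_sq_writhe_sub_writheApprox T)).const_mul |t|
  filter_upwards [h1.eventually (gt_mem_nhds hT1),
    Metric.tendsto_nhds.1 (tendsto_integral_exp_writheApprox T t) (ε / 3) hε3] with n hn1 hn2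
  obtain ⟨C, hC⟩ := exists_abs_writhe_le n
  obtain ⟨D, hD⟩ := exists_abs_writheApprox_le n T
  have hm : Measurable fun U : ZMod (2 * n + 1) → UnitAddCircle =>
      (writhe n (circleLift ∘ U) : ℝ) / n :=
    ((measurable_writhe n).comp (measurable_pi_lambda _ fun i =>
      measurable_circleLift.comp (measurable_pi_apply i))).div_const _
  have h2 := (norm_integral_exp_sub_integral_exp_le (μ := volume) hm
    (continuous_writheApprox n T).measurable hC hD t).trans_lt hn1
  rw [← charFun_normalizedWritheLaw, ← dist_eq_norm] at h2
  calc dist _ _ ≤ _ := dist_triangle4 _ _ _ _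
    _ < ε / 3 + ε / 3 + ε / 3 := add_lt_add (add_lt_add h2 hn2) hT2
    _ = ε := by ring

/-! ### The limit theorem for the writhe. -/

theorem corollary2 :
    ∃ W : ProbabilityMeasure ℝ,
      -- the normalized writhe converges in distribution to `W`
      Tendsto normalizedWritheLaw atTop (𝓝 W) ∧
      -- `W` is a continuous distribution: it has a density
      (W : Measure ℝ) ≪ volume ∧
      -- the moment generating function of `W`
      (∀ z : ℂ, ‖z‖ < Real.pi ^ 2 / 4 →
        Integrable (fun x : ℝ => Complex.exp (z * x)) (W : Measure ℝ) ∧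
        Summable (fun m : ℕ => ((writheLambda (m + 1) / ((m + 1 : ℕ) : ℝ) : ℝ) : ℂ) * z ^ (m + 1)) ∧
        ∫ x : ℝ, Complex.exp (z * x) ∂(W : Measure ℝ) =
          Complex.exp
            (∑' m : ℕ, ((writheLambda (m + 1) / ((m + 1 : ℕ) : ℝ) : ℝ) : ℂ) * z ^ (m + 1))) ∧
      -- `W` is determined by its moment generating function near `0`
      (∀ V : ProbabilityMeasure ℝ,
        (∀ᶠ t : ℝ in 𝓝 0,
          Integrable (fun x : ℝ => Real.exp (t * x)) (V : Measure ℝ) ∧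
          ∫ x : ℝ, Real.exp (t * x) ∂(V : Measure ℝ) =
            Real.exp (∑' m : ℕ, writheLambda (m + 1) / ((m + 1 : ℕ) : ℝ) * t ^ (m + 1))) →
        V = W) ∧
      -- the power series of `log M` at `0` has radius of convergence `π² / 4`
      (HasFPowerSeriesAt
          (fun z : ℂ => Complex.log (∫ x : ℝ, Complex.exp (z * x) ∂(W : Measure ℝ)))
          writheLogSeries 0 ∧
        writheLogSeries.radius = ENNReal.ofReal (Real.pi ^ 2 / 4)) ∧
      -- the tails of `W` decay exponentially at rate `π² / 4`
      Tendsto (fun t : ℝ => (1 / t) * Real.log ((W : Measure ℝ).real {x : ℝ | t < |x|}))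
        atTop (𝓝 (-(Real.pi ^ 2 / 4))) := by
  obtain ⟨W, hch, hac, hint, htail⟩ := exists_writhe_limit_law
  have hR : 0 < Real.pi ^ 2 / 4 := by positivity
  have hmgf := fun (z : ℂ) (hz : ‖z‖ < Real.pi ^ 2 / 4) => integral_cexp_eq_of_charFun hch hint hz
  have hnear : ∀ᶠ t : ℝ in 𝓝 0, |t| < Real.pi ^ 2 / 4 :=
    (isOpen_lt (by fun_prop) (by fun_prop) :
      IsOpen {t : ℝ | |t| < Real.pi ^ 2 / 4}).mem_nhds (by simpa using hR)
  refine ⟨W, ProbabilityMeasure.tendsto_of_tendsto_charFun fun t => ?_, hac, fun z hz => ⟨?_,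
    summable_writheLambda_div_mul_pow hz, hmgf z hz⟩, fun V hV => ?_,
    ⟨?_, radius_writheLogSeries⟩, htail⟩
  · rw [hch]; exact tendsto_charFun_normalizedWritheLaw t
  · exact integrable_cexp_of_integrable_exp_re
      (hint _ ((Complex.abs_re_le_norm z).trans_lt hz))
  · suffices h : (V : Measure ℝ) = W from Subtype.ext h
    refine ext_of_eventually_mgf_eq (hV.mono fun t ht => ht.1)
      (hnear.mono fun t ht => hint t ht) ?_
    filter_upwards [hV, hnear] with t ht ht'
    have h1 : ((∫ x : ℝ, Real.exp (t * x) ∂(W : Measure ℝ) : ℝ) : ℂ) =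
        ((Real.exp (∑' m : ℕ, writheLambda (m + 1) / ((m + 1 : ℕ) : ℝ) * t ^ (m + 1)) : ℝ) : ℂ) := by
      rw [← integral_complex_ofReal, Complex.ofReal_exp, Complex.ofReal_tsum]
      push_cast
      simpa using hmgf t (by simpa using ht')
    rw [ht.2]
    exact_mod_cast h1.symm
  · have hS := hasFPowerSeriesOnBall_writheLogSeries.hasFPowerSeriesAt
    refine hS.congr ?_
    have hcont := hS.continuousAt
    have h0 : ∑' m : ℕ, ((writheLambda (m + 1) / ((m + 1 : ℕ) : ℝ) : ℝ) : ℂ) * (0 : ℂ) ^ (m + 1) =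
        0 := by simp
    have h1 := (Complex.continuous_im.continuousAt.comp hcont).abs
    -- Near `0` the series has imaginary part in `(-π, π)`, where the principal logarithm inverts
    -- the exponential.
    have h2 : ∀ᶠ z : ℂ in 𝓝 0, |(∑' m : ℕ, ((writheLambda (m + 1) / ((m + 1 : ℕ) : ℝ) : ℝ) : ℂ) *
        z ^ (m + 1)).im| < Real.pi := by
      refine h1.eventually (gt_mem_nhds ?_)
      simpa [h0] using Real.pi_pos
    filter_upwards [h2, Metric.ball_mem_nhds (0 : ℂ) hR] with z hz hz'
    rw [hmgf z (by simpa using hz'), Complex.log_exp (abs_lt.1 hz).1 (abs_lt.1 hz).2.le]
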